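/- **Setting.** For each $n$, observe $y=\theta^*+\epsilon\in\mathbb R^n$ with $\epsilon\sim N(0,I_n)$, where $\theta^*=\theta^{*(n)}$ has exactly $s=s^{(n)}\ge 1$ nonzero entries and $s=o(n)$. Let $\pi_0$ be a probability density on $\mathbb R$, strictly decreasing on $(0,\infty)$ and increasing on $(-\infty,0)$, with polynomial tail of order $\alpha>1$: there are constants $M>0$, $C_2>C_1>0$ with $C_1|x|^{-\alpha}\le\pi_0(x)\le C_2|x|^{-\alpha}$ for $|x|>M$. The prior on $\theta$ is $\pi(\theta\mid\tau)=\prod_{i=1}^n\tau^{-1}\pi_0(\theta_i/\tau)$, $\tau\sim\pi(\tau)$, where the hyperprior $\pi(\tau)$ is a probability distribution on $(0,\infty)$ that may depend on $n$. Let $\pi(\cdot\mid D_n)$ be the posterior given $D_n=y$ and $E^*$ the expectation under $\theta^*$. For sequences, $a_n\prec b_n$ means $a_n/b_n\to0$, $a_n\succ b_n$ means $a_n/b_n\to\infty$, and $-\log 0=+\infty$. **Theorem.** Let $\omega>0$ be fixed, and suppose that $1<\alpha\le 1+\omega/2$, that $$-\log\pi\{(s/n)^{(1+\omega/2)/(\alpha-1)}\le\tau\le(s/n)^{\alpha/(\alpha-1)}\}\prec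 s\log(n/s),\qquad -\log\pi\{\tau\ge(s/n)^{\alpha/(\alpha-1)}\}\succ s\log(n/s),$$ and that $\max_j|\theta^*_j|\le(n/s)^{\omega/(5\alpha)}$ for all large $n$. Then, as $n\to\infty$, $$E^*\bigl(\pi[\|\theta-\theta^*\|_2\ge C_1(\omega)\{s\log(n/s)\}^{1/2}\mid D_n]\bigr)\to0,\qquad E^*\bigl(\pi[\|\theta-\theta^*\|_1\ge s\,C_2(\omega)\{\log(n/s)\}^{1/2}\mid D_n]\bigr)\to0,$$ where $C_1(\omega)=\sqrt{2+\omega}+\sqrt{\omega}$ and $C_2(\omega)=\sqrt{2+\omega}+\sqrt{\omega^2/5}+\sqrt{\omega/5}$, which both tend to $\sqrt2$ as $\omega\downarrow0$. In particular, for every fixed $c\in\bigl(\tfrac{\alpha}{\alpha-1},\tfrac{1+\omega/2}{\alpha-1}\bigr)$ the hyperprior $\tau=\tau_0^c$, $\tau_0\sim\mathrm{Beta}(1,n)$, which does not depend on $s$, satisfies the two mass conditions, so both contractions hold for it. -/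

import Mathlib

open MeasureTheory ProbabilityTheory Filter Topology Set
open scoped ENNReal

noncomputable section

/-- `p` is a probability density on `ℝ`, strictly decreasing on `(0, ∞)`, increasing on `(-∞, 0)`,
with tails that decay polynomially with polynomial order `α`. -/
structure IsPolynomialTailDensity (p : ℝ → ℝ) (α : ℝ) : Prop where
  measurable : Measurable p
  nonneg : ∀ x, 0 ≤ p x
  lintegral_eq_one : ∫⁻ x, ENNReal.ofReal (p x) = 1
  strictAntiOn : StrictAntiOn p (Ioi 0)
  monotoneOn : MonotoneOn p (Iio 0)
  tail : ∃ M C₁ C₂ : ℝ, 0 < M ∧ 0 < C₁ ∧ C₁ < C₂ ∧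
    ∀ x : ℝ, M < |x| → C₁ * |x| ^ (-α) ≤ p x ∧ p x ≤ C₂ * |x| ^ (-α)

/-- The density at `θ ∈ ℝⁿ` of the shrinkage prior in which, given `τ`, the coordinates are
independent with density `(1/τ) π₀(·/τ)`, and `τ` has the distribution `ν`. -/
def priorDensity (π₀ : ℝ → ℝ) (ν : Measure ℝ) {n : ℕ} (θ : Fin n → ℝ) : ℝ≥0∞ :=
  ∫⁻ τ, ∏ i, ENNReal.ofReal ((1 / τ) * π₀ (θ i / τ)) ∂ν

/-- The likelihood of the mean vector `θ` for data `y ~ N(θ, Iₙ)`. -/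
def likelihood {n : ℕ} (θ y : Fin n → ℝ) : ℝ≥0∞ :=
  ∏ i, gaussianPDF (θ i) 1 (y i)

/-- The law of the data `y ~ N(θ, Iₙ)`. -/
def dataLaw {n : ℕ} (θ : Fin n → ℝ) : Measure (Fin n → ℝ) :=
  Measure.pi fun i => gaussianReal (θ i) 1

/-- The posterior probability `π(θ ∈ A | y)`, by Bayes' formula. -/
def posteriorProb (π₀ : ℝ → ℝ) (ν : Measure ℝ) {n : ℕ} (y : Fin n → ℝ)
    (A : Set (Fin n → ℝ)) : ℝ≥0∞ :=
  (∫⁻ θ in A, likelihood θ y * priorDensity π₀ ν θ) / ∫⁻ θ, likelihood θ y * priorDensity π₀ ν θ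

/-- `E*[π(θ ∈ A | y)]`, the expectation being over `y ~ N(θs, Iₙ)`. -/
def expectedPosteriorProb (π₀ : ℝ → ℝ) (ν : Measure ℝ) {n : ℕ} (θs : Fin n → ℝ)
    (A : Set (Fin n → ℝ)) : ℝ≥0∞ :=
  ∫⁻ y, posteriorProb π₀ ν y A ∂(dataLaw θs)

/-- `-log μ(A)`, with value `+∞` when `μ(A) = 0`. -/
def negLogMass (μ : Measure ℝ) (A : Set ℝ) : EReal := -ENNReal.log (μ A)

/-- Conditions on the hyperpriors `ν n` of `τ`: each is (for large `n`) a probability distribution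
on `(0, ∞)`, with
`-log ν{(s/n)^((1+ω/2)/(α-1)) ≤ τ ≤ (s/n)^(α/(α-1))} ≺ s log (n/s)` and
`-log ν{τ ≥ (s/n)^(α/(α-1))} ≻ s log (n/s)`,
where `a ≺ b` means `a / b → 0` and `a ≻ b` means `a / b → ∞`. -/
structure IsAdaptiveHyperprior (ω α : ℝ) (s : ℕ → ℕ) (ν : ℕ → Measure ℝ) : Prop where
  isProbabilityMeasure : ∀ᶠ n in atTop, IsProbabilityMeasure (ν n)
  pos : ∀ᶠ n in atTop, ν n (Iic 0) = 0
  mass_optimal : Tendsto (fun n : ℕ =>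
      negLogMass (ν n) (Icc (((s n : ℝ) / n) ^ ((1 + ω / 2) / (α - 1)))
        (((s n : ℝ) / n) ^ (α / (α - 1)))) /
      (((s n : ℝ) * Real.log ((n : ℝ) / s n) : ℝ) : EReal)) atTop (𝓝 0)
  mass_large : Tendsto (fun n : ℕ =>
      negLogMass (ν n) (Ici (((s n : ℝ) / n) ^ (α / (α - 1)))) /
      (((s n : ℝ) * Real.log ((n : ℝ) / s n) : ℝ) : EReal)) atTop (𝓝 ⊤)

/-- The constant of the `L₂` contraction. -/
def constL2 (ω : ℝ) : ℝ := √(2 + ω) + √ω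

/-- The constant of the `L₁` contraction. -/
def constL1 (ω : ℝ) : ℝ := √(2 + ω) + √(ω ^ 2 / 5) + √(ω / 5)

/-- `lim E*(π[‖θ - θ*‖ ≥ C₁(ω) {s log(n/s)}^(1/2) | Dₙ]) = 0`. -/
def ContractsL2 (ω : ℝ) (π₀ : ℝ → ℝ) (s : ℕ → ℕ) (θs : ∀ n, Fin n → ℝ)
    (ν : ℕ → Measure ℝ) : Prop :=
  Tendsto (fun n : ℕ => expectedPosteriorProb π₀ (ν n) (θs n)
    {θ | constL2 ω * √(s n * Real.log ((n : ℝ) / s n)) ≤ ‖WithLp.toLp 2 (θ - θs n)‖})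
    atTop (𝓝 0)

/-- `lim E*(π[‖θ - θ*‖₁ ≥ s C₂(ω) {log(n/s)}^(1/2) | Dₙ]) = 0`. -/
def ContractsL1 (ω : ℝ) (π₀ : ℝ → ℝ) (s : ℕ → ℕ) (θs : ∀ n, Fin n → ℝ)
    (ν : ℕ → Measure ℝ) : Prop :=
  Tendsto (fun n : ℕ => expectedPosteriorProb π₀ (ν n) (θs n)
    {θ | s n * constL1 ω * √(Real.log ((n : ℝ) / s n)) ≤ ‖WithLp.toLp 1 (θ - θs n)‖})
    atTop (𝓝 0)

/-- The law of `τ = τ₀ ^ c` with `τ₀ ~ Beta(1, n)`; it does not depend on the sparsity. -/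
def betaHyperprior (c : ℝ) (n : ℕ) : Measure ℝ :=
  (betaMeasure 1 n).map fun t => t ^ c

end

/-! Write `r = s/n`, `L = log (n/s)`, and let `S` be the support of the truth. Given `τ` the
posterior factorises over coordinates. The numerator and denominator of Bayes' formula are compared
after division by the pure-noise density of the null coordinates (those outside `S`). Three sources
of posterior mass must be shown negligible.

Null coordinates far from 0. If `τ ≤ r^(α/(α-1))`, the posterior mean of `|t| + t²` at a null
coordinate is at most `r A exp(b y²)` with `b < 1/2` (`exists_lintegral_abs_add_sq_le`). This has
expectation `O(r)` under `N(0,1)`, so the `n` coordinates contribute `O(nr) = O(s)` in total, and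
Markov's inequality at level `s √L` leaves `O(1/√L)`. Controlling `|t| + t²` serves both norms at
once.

Signal coordinates far from the truth. There the likelihood is at most `exp(-E)`, where `E` is about
half the squared distance, and the prior of these coordinates integrates to 1.

Large `τ`. Under the truth, the likelihood ratio of the null data against pure noise has expectation
1 for every `τ`, so the expected contribution of a set of scales is at most its hyperprior mass
(`lintegral_nullRatio_le`).

The last two are weighed against a lower bound for the denominator, from the scales between
`r^((1+ω/2)/(α-1))` and `r^(α/(α-1))` (`exists_le_lintegral_prod_marginalDensity`). The upper end
makes the prior concentrate enough that all null coordinates together cost only `exp(-O(s))` up to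
noise. The lower end makes each signal cost about `(1 + ω/2) L` through the factor `τ^(α-1)`;
signals of size at most `(n/s)^(ω/(5α))` cost another `(ω/5) L`. So the denominator is about
`exp(-(1 + 7ω/10) s L)`. A squared signal error of `(2 + 3ω/2) s L` gives `exp(-(1 + 3ω/4) s L)`,
which is smaller, and the mass of large `τ` is smaller still by hypothesis. The constants of both
norms leave room above `2 + 3ω/2` and its square root for the null coordinates. -/

/-! ### Integration tools: products, scaling, power tails -/

/-- Tonelli's theorem for a product of functions of one coordinate each. -/
theorem lintegral_pi_prod {n : ℕ} {μ : Fin n → Measure ℝ} [∀ i, SigmaFinite (μ i)]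
    {f : Fin n → ℝ → ℝ≥0∞} (hf : ∀ i, Measurable (f i)) :
    ∫⁻ x : Fin n → ℝ, ∏ i, f i (x i) ∂(Measure.pi μ) = ∏ i, ∫⁻ x, f i x ∂(μ i) := by
  induction n with
  | zero => simp
  | succ n ih =>
    rw [← ((measurePreserving_piFinSuccAbove μ 0).symm).lintegral_comp_emb
      (MeasurableEquiv.measurableEmbedding _), Fin.prod_univ_succ,
      ← ih (fun i => hf i.succ), ← lintegral_prod_mul (hf 0).aemeasurable]
    · refine lintegral_congr fun x => ?_
      simp [MeasurableEquiv.piFinSuccAbove_symm_apply, Fin.insertNthEquiv, Fin.prod_univ_succ]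
    · exact (Finset.measurable_prod _ fun i _ =>
        (hf i.succ).comp (measurable_pi_apply i)).aemeasurable

theorem lintegral_pi_eval {n : ℕ} {μ : Fin n → Measure ℝ} [∀ i, IsProbabilityMeasure (μ i)]
    {f : ℝ → ℝ≥0∞} (hf : Measurable f) (i : Fin n) :
    ∫⁻ x : Fin n → ℝ, f (x i) ∂(Measure.pi μ) = ∫⁻ x, f x ∂(μ i) := by
  exact (measurePreserving_eval μ i).lintegral_comp hf

theorem lintegral_comp_const_mul {f : ℝ → ℝ≥0∞} (hf : Measurable f) {c : ℝ} (hc : 0 < c) :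
    ∫⁻ x, f x = ENNReal.ofReal c * ∫⁻ x, f (c * x) := by
  conv_lhs => rw [← Real.smul_map_volume_mul_left hc.ne']
  rw [lintegral_smul_measure, lintegral_map hf (measurable_const_mul c), abs_of_pos hc, smul_eq_mul]

theorem lintegral_rpow_neg_abs_gt {a t : ℝ} (ha : 1 < a) (ht : 0 < t) :
    ∫⁻ x in {x : ℝ | t < |x|}, ENNReal.ofReal (|x| ^ (-a)) ≤
      ENNReal.ofReal (2 / (a - 1) * t ^ (1 - a)) := by
  have hI : ∫⁻ x in Ioi t, ENNReal.ofReal (|x| ^ (-a)) =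
      ENNReal.ofReal (1 / (a - 1) * t ^ (1 - a)) := by
    rw [← ofReal_integral_eq_lintegral_ofReal]
    · congr 1
      rw [setIntegral_congr_fun (g := fun x => x ^ (-a)) measurableSet_Ioi, 
        integral_Ioi_rpow_of_lt (by linarith) ht]
      · have : a - 1 ≠ 0 := by linarith
        have h2 : -a + 1 ≠ 0 := by linarith
        rw [show -a + 1 = -(a - 1) by ring, show 1 - a = -(a-1) by ring]
        field_simp
      · intro x hx
        simp only [abs_of_pos (ht.trans hx)]
    · refine (integrableOn_Ioi_rpow_of_lt (a := -a) (by linarith) ht).congr_fun ?_ measurableSet_Ioi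
      intro x hx
      simp only [abs_of_pos (ht.trans hx)]
    · exact ae_of_all _ fun x => by positivity
  have hneg : ∫⁻ x in Iio (-t), ENNReal.ofReal (|x| ^ (-a)) =
      ∫⁻ x in Ioi t, ENNReal.ofReal (|x| ^ (-a)) := by
    have := (Measure.measurePreserving_neg (volume : Measure ℝ)).setLIntegral_comp_preimage_emb
      (MeasurableEquiv.neg ℝ).measurableEmbedding (fun x => ENNReal.ofReal (|x| ^ (-a))) (Ioi t)
    rw [← this]
    simp [Set.neg_Ioi]
  have hset : {x : ℝ | t < |x|} = Iio (-t) ∪ Ioi t := by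
    ext x
    simp only [mem_ofPred_eq, lt_abs, mem_union, mem_Iio, mem_Ioi]
    constructor
    · rintro (h | h)
      · exact Or.inr h
      · left; linarith
    · rintro (h | h)
      · right; linarith
      · exact Or.inl h
  rw [hset]
  refine (lintegral_union_le _ _ _).trans ?_
  have : 0 < a - 1 := by linarith
  rw [hneg, hI, ← ENNReal.ofReal_add (by positivity) (by positivity)]
  apply ENNReal.ofReal_le_ofReal
  apply le_of_eq; ring

/-! ### The coordinate prior at scale `τ` -/

/-- The prior density of one coordinate given the scale `τ`. -/
noncomputable def scaledDensity (π₀ : ℝ → ℝ) (τ x : ℝ) : ℝ≥0∞ :=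
  ENNReal.ofReal ((1 / τ) * π₀ (x / τ))

/-- The marginal density of one observation given the scale `τ`. -/
noncomputable def marginalDensity (π₀ : ℝ → ℝ) (τ y : ℝ) : ℝ≥0∞ :=
  ∫⁻ t, gaussianPDF t 1 y * scaledDensity π₀ τ t

theorem gaussianPDF_one_eq (t y : ℝ) :
    gaussianPDF t 1 y = ENNReal.ofReal ((√(2 * Real.pi))⁻¹ * Real.exp (-(y - t) ^ 2 / 2)) := by
  simp [gaussianPDF, gaussianPDFReal]

theorem gaussianPDF_one_comm (t y : ℝ) : gaussianPDF t 1 y = gaussianPDF y 1 t := by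
  rw [gaussianPDF_one_eq, gaussianPDF_one_eq, show (y - t) ^ 2 = (t - y) ^ 2 by ring]

theorem gaussianPDF_one_le_one (t y : ℝ) : gaussianPDF t 1 y ≤ 1 := by
  rw [gaussianPDF_one_eq, ← ENNReal.ofReal_one]
  apply ENNReal.ofReal_le_ofReal
  have h1 : (√(2 * Real.pi))⁻¹ ≤ 1 := by
    apply inv_le_one_of_one_le₀
    rw [Real.one_le_sqrt]
    linarith [Real.pi_gt_three]
  have h2 : Real.exp (-(y - t) ^ 2 / 2) ≤ 1 := by
    rw [Real.exp_le_one_iff]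
    nlinarith [sq_nonneg (y - t)]
  exact mul_le_one₀ h1 (Real.exp_nonneg _) h2

theorem measurable_gaussianPDF_one_prod :
    Measurable fun q : ℝ × ℝ => gaussianPDF q.1 1 q.2 := by
  simp_rw [gaussianPDF_one_eq]
  fun_prop

theorem measurable_gaussianPDF_one_left (y : ℝ) : Measurable fun t : ℝ => gaussianPDF t 1 y := by
  simp_rw [gaussianPDF_one_eq]
  fun_prop

theorem gaussianPDF_one_pos (t y : ℝ) : 0 < gaussianPDF t 1 y :=
  gaussianPDF_pos _ one_ne_zero _

namespace IsPolynomialTailDensity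

variable {π₀ : ℝ → ℝ} {α : ℝ}

theorem measurable_scaledDensity_prod (h : IsPolynomialTailDensity π₀ α) :
    Measurable fun q : ℝ × ℝ => scaledDensity π₀ q.1 q.2 := by
  have := h.measurable
  unfold scaledDensity
  fun_prop

theorem measurable_scaledDensity (h : IsPolynomialTailDensity π₀ α) (τ : ℝ) :
    Measurable (scaledDensity π₀ τ) := by
  have := h.measurable
  unfold scaledDensity
  fun_prop

theorem lintegral_mul_scaledDensity (h : IsPolynomialTailDensity π₀ α) {f : ℝ → ℝ≥0∞}
    (hf : Measurable f) {τ : ℝ} (hτ : 0 < τ) :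
    ∫⁻ x, f x * scaledDensity π₀ τ x = ∫⁻ u, f (τ * u) * ENNReal.ofReal (π₀ u) := by
  rw [lintegral_comp_const_mul (f := fun x => f x * scaledDensity π₀ τ x)
    (hf.mul (h.measurable_scaledDensity τ)) hτ, ← lintegral_const_mul]
  · refine lintegral_congr fun u => ?_
    rw [scaledDensity, mul_div_cancel_left₀ _ hτ.ne', mul_left_comm,
      ← ENNReal.ofReal_mul hτ.le]
    congr 2
    field_simp
  · exact (hf.mul (h.measurable_scaledDensity τ)).comp (measurable_const_mul τ)

theorem lintegral_scaledDensity (h : IsPolynomialTailDensity π₀ α) {τ : ℝ} (hτ : 0 < τ) :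
    ∫⁻ x, scaledDensity π₀ τ x = 1 := by
  have := h.lintegral_mul_scaledDensity (f := fun _ => 1) measurable_const hτ
  simpa [h.lintegral_eq_one] using this

theorem exists_scaledDensity_bounds (h : IsPolynomialTailDensity π₀ α) :
    ∃ M C₁ C₂ : ℝ, 0 < M ∧ 0 < C₁ ∧ 0 < C₂ ∧ ∀ τ x : ℝ, 0 < τ → M * τ < |x| →
      ENNReal.ofReal (C₁ * τ ^ (α - 1) * |x| ^ (-α)) ≤ scaledDensity π₀ τ x ∧
      scaledDensity π₀ τ x ≤ ENNReal.ofReal (C₂ * τ ^ (α - 1) * |x| ^ (-α)) := by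
  obtain ⟨M, C₁, C₂, hM, hC₁, hC, hb⟩ := h.tail
  refine ⟨M, C₁, C₂, hM, hC₁, hC₁.trans hC, fun τ x hτ hx => ?_⟩
  have hx0 : 0 < |x| := lt_trans (by positivity) hx
  have habs : |x / τ| = |x| / τ := by rw [abs_div, abs_of_pos hτ]
  have hxτ : M < |x / τ| := by rw [habs, lt_div_iff₀ hτ]; exact hx
  obtain ⟨h1, h2⟩ := hb _ hxτ
  have key : ∀ C : ℝ, C * τ ^ (α - 1) * |x| ^ (-α) = 1 / τ * (C * |x / τ| ^ (-α)) := by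
    intro C
    rw [habs, Real.div_rpow hx0.le hτ.le, Real.rpow_sub_one hτ.ne', Real.rpow_neg hτ.le]
    have : τ ^ α ≠ 0 := (Real.rpow_pos_of_pos hτ α).ne'
    field_simp
  constructor
  · rw [key]
    apply ENNReal.ofReal_le_ofReal
    gcongr
  · rw [key]
    apply ENNReal.ofReal_le_ofReal
    gcongr

/-- Moving halfway towards 0 does not cross it, so each one-sided monotonicity applies. This is the
only place where the shape of `π₀` enters, as opposed to its tails. -/
theorem scaledDensity_le_half (h : IsPolynomialTailDensity π₀ α) {τ x : ℝ} (hτ : 0 < τ)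
    (hx : x ≠ 0) : scaledDensity π₀ τ x ≤ scaledDensity π₀ τ (x / 2) := by
  apply ENNReal.ofReal_le_ofReal
  gcongr ?_ * ?_
  rcases hx.lt_or_gt with hx | hx
  · have hq : x / τ < 0 := div_neg_of_neg_of_pos hx hτ
    have hq2 : x / 2 / τ = x / τ / 2 := by ring
    rw [hq2]
    exact h.monotoneOn hq (by simp only [mem_Iio]; linarith) (by linarith)
  · have hq : 0 < x / τ := div_pos hx hτ
    have hq2 : x / 2 / τ = x / τ / 2 := by ring
    rw [hq2]
    exact h.strictAntiOn.antitoneOn (by simp only [mem_Ioi]; linarith) hq (by linarith)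

/-- Substituting `x = τ u` extracts `τ ^ κ` and leaves the `κ`-th moment of `π₀`, finite because its
tail integrand has order `κ - α < -1`. -/
theorem exists_lintegral_rpow_abs_le (h : IsPolynomialTailDensity π₀ α) {κ : ℝ} (hκ : 0 < κ)
    (hκα : κ < α - 1) :
    ∃ C : ℝ, 0 < C ∧ ∀ τ : ℝ, 0 < τ →
      ∫⁻ x, ENNReal.ofReal (|x| ^ κ) * scaledDensity π₀ τ x ≤ ENNReal.ofReal (C * τ ^ κ) := by
  obtain ⟨M, C₁, C₂, hM, hC₁, hC, hb⟩ := h.tail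
  have hC₂ : 0 < C₂ := hC₁.trans hC
  have hak : 1 < α - κ := by linarith
  set D := M ^ κ + C₂ * (2 / (α - κ - 1) * M ^ (1 - (α - κ))) with hD
  have h1 : 0 < α - κ - 1 := by linarith
  have hDpos : 0 < D := by positivity
  have hbase : ∫⁻ u, ENNReal.ofReal (|u| ^ κ) * ENNReal.ofReal (π₀ u) ≤ ENNReal.ofReal D := by
    have hms : MeasurableSet {x : ℝ | M < |x|} := measurableSet_lt measurable_const measurable_norm
    rw [← lintegral_add_compl _ hms, add_comm, hD, ENNReal.ofReal_add (by positivity) (by positivity)]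
    gcongr
    · calc ∫⁻ u in {x : ℝ | M < |x|}ᶜ, ENNReal.ofReal (|u| ^ κ) * ENNReal.ofReal (π₀ u)
          ≤ ∫⁻ u in {x : ℝ | M < |x|}ᶜ, ENNReal.ofReal (M ^ κ) * ENNReal.ofReal (π₀ u) := by
            refine setLIntegral_mono' hms.compl fun u hu => ?_
            have hu' : |u| ≤ M := by simpa using hu
            gcongr
        _ ≤ ∫⁻ u, ENNReal.ofReal (M ^ κ) * ENNReal.ofReal (π₀ u) := setLIntegral_le_lintegral _ _
        _ = ENNReal.ofReal (M ^ κ) := by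
            rw [lintegral_const_mul _ h.measurable.ennreal_ofReal, h.lintegral_eq_one, mul_one]
    · calc ∫⁻ u in {x : ℝ | M < |x|}, ENNReal.ofReal (|u| ^ κ) * ENNReal.ofReal (π₀ u)
          ≤ ∫⁻ u in {x : ℝ | M < |x|}, ENNReal.ofReal C₂ * ENNReal.ofReal (|u| ^ (-(α - κ))) := by
            refine setLIntegral_mono' hms fun u hu => ?_
            have hu' : M < |u| := hu
            have hu0 : 0 < |u| := hM.trans hu'
            rw [← ENNReal.ofReal_mul (by positivity), ← ENNReal.ofReal_mul (by positivity)]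
            apply ENNReal.ofReal_le_ofReal
            calc |u| ^ κ * π₀ u ≤ |u| ^ κ * (C₂ * |u| ^ (-α)) := by
                  gcongr
                  exact (hb u hu').2
              _ = C₂ * |u| ^ (-(α - κ)) := by
                  rw [show -(α - κ) = κ + -α by ring, Real.rpow_add hu0]
                  ring
        _ = ENNReal.ofReal C₂ * ∫⁻ u in {x : ℝ | M < |x|}, ENNReal.ofReal (|u| ^ (-(α - κ))) := by
            rw [lintegral_const_mul' _ _ ENNReal.ofReal_ne_top]
        _ ≤ ENNReal.ofReal C₂ * ENNReal.ofReal (2 / (α - κ - 1) * M ^ (1 - (α - κ))) := by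
            gcongr
            exact lintegral_rpow_neg_abs_gt hak hM
        _ = _ := by rw [ENNReal.ofReal_mul hC₂.le]
  refine ⟨D, hDpos, fun τ hτ => ?_⟩
  rw [h.lintegral_mul_scaledDensity (by fun_prop) hτ]
  calc ∫⁻ u, ENNReal.ofReal (|τ * u| ^ κ) * ENNReal.ofReal (π₀ u)
      = ∫⁻ u, ENNReal.ofReal (τ ^ κ) * (ENNReal.ofReal (|u| ^ κ) * ENNReal.ofReal (π₀ u)) := by
        refine lintegral_congr fun u => ?_
        rw [abs_mul, abs_of_pos hτ, Real.mul_rpow hτ.le (abs_nonneg _),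
          ENNReal.ofReal_mul (by positivity), mul_assoc]
    _ = ENNReal.ofReal (τ ^ κ) * ∫⁻ u, ENNReal.ofReal (|u| ^ κ) * ENNReal.ofReal (π₀ u) := by
        rw [lintegral_const_mul' _ _ ENNReal.ofReal_ne_top]
    _ ≤ ENNReal.ofReal (τ ^ κ) * ENNReal.ofReal D := by gcongr
    _ = _ := by rw [← ENNReal.ofReal_mul (by positivity), mul_comm]

/-- Beyond `M τ` the prior is dominated by its power tail, whose integral past `δ` has order
`(τ/δ)^(α-1)`. The additive form avoids truncated subtraction in `ℝ≥0∞`. -/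
theorem exists_one_le_lintegral_abs_le (h : IsPolynomialTailDensity π₀ α) (hα : 1 < α) :
    ∃ M C : ℝ, 0 < M ∧ 0 < C ∧ ∀ τ δ : ℝ, 0 < τ → 0 < δ → M * τ ≤ δ →
      1 ≤ (∫⁻ x in {x : ℝ | |x| ≤ δ}, scaledDensity π₀ τ x) +
        ENNReal.ofReal (C * (τ / δ) ^ (α - 1)) := by
  obtain ⟨M, C₁, C₂, hM, -, hC₂, hb⟩ := h.exists_scaledDensity_bounds
  have h1 : 0 < α - 1 := by linarith
  refine ⟨M, C₂ * (2 / (α - 1)), hM, by positivity, fun τ δ hτ hδ hMδ => ?_⟩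
  have hms : MeasurableSet {x : ℝ | |x| ≤ δ} := measurableSet_le measurable_norm measurable_const
  refine (h.lintegral_scaledDensity hτ).ge.trans ?_
  rw [← lintegral_add_compl (μ := volume) _ hms]
  gcongr
  have hc : {x : ℝ | |x| ≤ δ}ᶜ = {x : ℝ | δ < |x|} := by ext; simp
  rw [hc]
  have hms' : MeasurableSet {x : ℝ | δ < |x|} := measurableSet_lt measurable_const measurable_norm
  calc ∫⁻ x in {x : ℝ | δ < |x|}, scaledDensity π₀ τ x
      ≤ ∫⁻ x in {x : ℝ | δ < |x|},
          ENNReal.ofReal (C₂ * τ ^ (α - 1)) * ENNReal.ofReal (|x| ^ (-α)) := by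
        refine setLIntegral_mono' hms' fun x hx => ?_
        rw [← ENNReal.ofReal_mul (by positivity)]
        exact (hb τ x hτ (lt_of_le_of_lt hMδ hx)).2
    _ ≤ ENNReal.ofReal (C₂ * τ ^ (α - 1)) * ENNReal.ofReal (2 / (α - 1) * δ ^ (1 - α)) := by
        rw [lintegral_const_mul' _ _ ENNReal.ofReal_ne_top]
        gcongr
        exact lintegral_rpow_neg_abs_gt hα hδ
    _ = _ := by
        rw [← ENNReal.ofReal_mul (by positivity), Real.div_rpow hτ.le hδ.le,
          show 1 - α = -(α - 1) by ring, Real.rpow_neg hδ.le]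
        congr 1
        field_simp

end IsPolynomialTailDensity

/-! ### Posterior moments at a null coordinate -/

theorem gaussianPDF_one_eq_zero_mul (t y : ℝ) :
    gaussianPDF t 1 y = gaussianPDF 0 1 y * ENNReal.ofReal (Real.exp (y * t - t ^ 2 / 2)) := by
  rw [gaussianPDF_one_eq, gaussianPDF_one_eq, ← ENNReal.ofReal_mul (by positivity), mul_assoc,
    ← Real.exp_add]
  congr 3
  ring

theorem lintegral_sq_sub_gaussianReal (θ : ℝ) :
    ∫⁻ x, ENNReal.ofReal ((x - θ) ^ 2) ∂(gaussianReal θ 1) = 1 := by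
  have h := ofReal_variance (memLp_id_gaussianReal' (μ := θ) (v := 1) 2 (by simp))
  rw [variance_id_gaussianReal, evariance] at h
  simp only [id_eq, integral_id_gaussianReal, NNReal.coe_one, ENNReal.ofReal_one] at h
  rw [h]
  refine lintegral_congr fun x => ?_
  rw [← ofReal_norm, ← ENNReal.ofReal_pow (norm_nonneg _), Real.norm_eq_abs, sq_abs]

theorem lintegral_gaussianReal_one (θ : ℝ) {f : ℝ → ℝ≥0∞} (hf : Measurable f) :
    ∫⁻ x, f x ∂(gaussianReal θ 1) = ∫⁻ x, gaussianPDF θ 1 x * f x := by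
  rw [gaussianReal_of_var_ne_zero _ one_ne_zero,
    lintegral_withDensity_eq_lintegral_mul _ (measurable_gaussianPDF _ _) hf]
  rfl

theorem lintegral_sq_mul_gaussianPDF_le (y : ℝ) :
    ∫⁻ t, ENNReal.ofReal (t ^ 2) * gaussianPDF t 1 y ≤ ENNReal.ofReal (2 * (1 + y ^ 2)) := by
  calc ∫⁻ t, ENNReal.ofReal (t ^ 2) * gaussianPDF t 1 y
      = ∫⁻ t, ENNReal.ofReal (t ^ 2) ∂(gaussianReal y 1) := by
        rw [lintegral_gaussianReal_one _ (by fun_prop)]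
        refine lintegral_congr fun t => ?_
        rw [mul_comm, gaussianPDF_one_comm]
    _ ≤ ∫⁻ t, (ENNReal.ofReal (2 * y ^ 2) + ENNReal.ofReal 2 * ENNReal.ofReal ((t - y) ^ 2))
          ∂(gaussianReal y 1) := by
        refine lintegral_mono fun t => ?_
        rw [← ENNReal.ofReal_mul (by positivity), ← ENNReal.ofReal_add (by positivity)
          (by positivity)]
        apply ENNReal.ofReal_le_ofReal
        nlinarith [sq_nonneg (t - y - y)]
    _ = ENNReal.ofReal (2 * (1 + y ^ 2)) := by
        rw [lintegral_add_left measurable_const, lintegral_const_mul' _ _ ENNReal.ofReal_ne_top,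
          lintegral_sq_sub_gaussianReal, lintegral_const, measure_univ, mul_one, mul_one,
          ← ENNReal.ofReal_add (by positivity) (by positivity)]
        congr 1
        ring

theorem abs_add_sq_le_two_mul_sq {t : ℝ} (ht : 1 < |t|) : |t| + t ^ 2 ≤ 2 * t ^ 2 := by
  rw [← sq_abs t]
  nlinarith

theorem one_eq_mul_gaussianPDF (y : ℝ) :
    1 = ENNReal.ofReal (√(2 * Real.pi) * Real.exp (y ^ 2 / 2)) * gaussianPDF 0 1 y := by
  rw [gaussianPDF_one_eq, ← ENNReal.ofReal_mul (by positivity)]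
  have e1 : Real.exp (y ^ 2 / 2) * Real.exp (-(y - 0) ^ 2 / 2) = 1 := by
    rw [← Real.exp_add, Real.exp_eq_one_iff]
    ring
  have e2 : √(2 * Real.pi) * (√(2 * Real.pi))⁻¹ = 1 := mul_inv_cancel₀ (by positivity)
  rw [show √(2 * Real.pi) * Real.exp (y ^ 2 / 2) *
      ((√(2 * Real.pi))⁻¹ * Real.exp (-(y - 0) ^ 2 / 2)) = (√(2 * Real.pi) * (√(2 * Real.pi))⁻¹) *
      (Real.exp (y ^ 2 / 2) * Real.exp (-(y - 0) ^ 2 / 2)) by ring, e1, e2, one_mul,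
    ENNReal.ofReal_one]

theorem two_mul_abs_le {η : ℝ} (hη : 0 < η) (y : ℝ) : 2 * |y| ≤ 1 / η + η * y ^ 2 := by
  have h1 : 0 ≤ (1 - η * |y|) ^ 2 := sq_nonneg _
  calc 2 * |y| ≤ (1 + η ^ 2 * |y| ^ 2) / η := by
        rw [le_div_iff₀ hη]
        linarith
    _ = 1 / η + η * y ^ 2 := by
        rw [sq_abs]
        field_simp

theorem min_one_le_rpow {z p : ℝ} (hz : 0 < z) (hp0 : 0 ≤ p) (hp1 : p ≤ 1) : min z 1 ≤ z ^ p := by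
  rcases le_total z 1 with hz1 | hz1
  · rw [min_eq_left hz1]
    calc z = z ^ (1 : ℝ) := (Real.rpow_one _).symm
      _ ≤ z ^ p := Real.rpow_le_rpow_of_exponent_ge hz hz1 hp1
  · rw [min_eq_right hz1]
    exact Real.one_le_rpow hz1 hp0

/-- Interpolating between a bound that is good for small `y` and one that is good for large `y`. -/
theorem one_add_sq_mul_min_le {α η r : ℝ} (hα : 1 < α) (hη0 : 0 < η) (hη1 : η ≤ 1) (hr : 0 < r)
    (y : ℝ) :
    (1 + y ^ 2) * min (r ^ α * Real.exp (y ^ 2 / 2 + |y|)) 1 ≤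
      r * (1 / η * Real.exp (1 / η) * Real.exp ((1 / α / 2 + 2 * η) * y ^ 2)) := by
  have hα0 : 0 < α := by linarith
  have hα' : 1 / α < 1 := by rw [div_lt_one hα0]; exact hα
  have hα'0 : 0 < 1 / α := by positivity
  have hpoly : 1 + y ^ 2 ≤ 1 / η * Real.exp (η * y ^ 2) := by
    have h1 := Real.add_one_le_exp (η * y ^ 2)
    rw [div_mul_eq_mul_div, one_mul, le_div_iff₀ hη0]
    nlinarith [sq_nonneg y]
  -- The exponent `1/α` turns `r ^ α` into the required factor `r` and lowers the Gaussian exponent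
  -- from `y²/2` to `y²/(2α)`, which is integrable against `N(0,1)` since `α > 1`.
  have hz : min (r ^ α * Real.exp (y ^ 2 / 2 + |y|)) 1 ≤
      r * Real.exp (1 / α * (y ^ 2 / 2 + |y|)) := by
    refine (min_one_le_rpow (by positivity) hα'0.le hα'.le).trans_eq ?_
    rw [Real.mul_rpow (by positivity) (by positivity), ← Real.rpow_mul hr.le,
      mul_one_div_cancel hα0.ne', Real.rpow_one, ← Real.exp_mul, mul_comm (1 / α)]
  have hexp : 1 / α * (y ^ 2 / 2 + |y|) ≤ 1 / α / 2 * y ^ 2 + (1 / η + η * y ^ 2) := by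
    have h1 := two_mul_abs_le hη0 y
    have h2 : 1 / α * |y| ≤ 1 * |y| := by gcongr
    have h3 := abs_nonneg y
    linarith
  calc (1 + y ^ 2) * min (r ^ α * Real.exp (y ^ 2 / 2 + |y|)) 1
      ≤ (1 / η * Real.exp (η * y ^ 2)) * (r * Real.exp (1 / α / 2 * y ^ 2 +
          (1 / η + η * y ^ 2))) := by
        refine mul_le_mul hpoly (hz.trans ?_) (by positivity) (by positivity)
        exact mul_le_mul_of_nonneg_left (Real.exp_le_exp.2 hexp) hr.le
    _ = _ := by
        rw [show (1 / α / 2 + 2 * η) * y ^ 2 = 1 / α / 2 * y ^ 2 + η * y ^ 2 + η * y ^ 2 by ring]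
        simp only [Real.exp_add]
        ring

/-- For `|t| ≤ 1` the weight is at most `2 |t| ^ κ` and the likelihood at `t` exceeds that at 0 by
at most `exp |y|`, so the `κ`-th prior moment controls the integral. A second `exp |y|` comes from
replacing the noise density by the marginal. -/
theorem lintegral_abs_le_one_le {π₀ : ℝ → ℝ} {κ D c τ y : ℝ} (hκ0 : 0 < κ)
    (hκ1 : κ ≤ 1) (hD : 0 < D) (hτ : 0 < τ)
    (hmom : ∫⁻ x, ENNReal.ofReal (|x| ^ κ) * scaledDensity π₀ τ x ≤ ENNReal.ofReal (D * τ ^ κ))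
    (hφ : gaussianPDF 0 1 y ≤ ENNReal.ofReal (c * Real.exp |y|) * marginalDensity π₀ τ y) :
    ∫⁻ t in {t : ℝ | |t| ≤ 1},
      ENNReal.ofReal (|t| + t ^ 2) * (gaussianPDF t 1 y * scaledDensity π₀ τ t) ≤
      ENNReal.ofReal (τ ^ κ * (2 * D * c * (Real.exp |y| * Real.exp |y|))) *
        marginalDensity π₀ τ y := by
  have hms : MeasurableSet {t : ℝ | |t| ≤ 1} :=
    measurableSet_le measurable_norm measurable_const
  set m := marginalDensity π₀ τ y with hm
  have hpt : ∀ t : ℝ, |t| ≤ 1 →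
      ENNReal.ofReal (|t| + t ^ 2) * (gaussianPDF t 1 y * scaledDensity π₀ τ t) ≤
      (ENNReal.ofReal (2 * Real.exp |y|) * gaussianPDF 0 1 y) *
        (ENNReal.ofReal (|t| ^ κ) * scaledDensity π₀ τ t) := by
    intro t ht1
    have e1 : |t| + t ^ 2 ≤ 2 * |t| ^ κ := by
      have h1 : |t| ≤ |t| ^ κ := by
        rcases (abs_nonneg t).eq_or_lt with h0 | h0
        · rw [← h0, Real.zero_rpow hκ0.ne']
        · calc |t| = |t| ^ (1 : ℝ) := (Real.rpow_one _).symm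
            _ ≤ |t| ^ κ := Real.rpow_le_rpow_of_exponent_ge h0 ht1 hκ1
      have h2 : t ^ 2 ≤ |t| := by
        rw [← sq_abs t]
        nlinarith [abs_nonneg t]
      linarith
    have e2 : Real.exp (y * t - t ^ 2 / 2) ≤ Real.exp |y| := by
      apply Real.exp_le_exp.2
      have : y * t ≤ |y| * 1 := by
        refine (le_abs_self _).trans ?_
        rw [abs_mul]
        gcongr
      nlinarith [sq_nonneg t]
    rw [gaussianPDF_one_eq_zero_mul t y, ENNReal.ofReal_mul zero_le_two]
    calc _ ≤ ENNReal.ofReal (2 * |t| ^ κ) * (gaussianPDF 0 1 y *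
          ENNReal.ofReal (Real.exp |y|) * scaledDensity π₀ τ t) := by gcongr
      _ = _ := by
        rw [ENNReal.ofReal_mul zero_le_two]
        ring
  calc _ ≤ ∫⁻ t in {t : ℝ | |t| ≤ 1}, (ENNReal.ofReal (2 * Real.exp |y|) * gaussianPDF 0 1 y) *
          (ENNReal.ofReal (|t| ^ κ) * scaledDensity π₀ τ t) :=
        setLIntegral_mono' hms fun t ht => hpt t ht
    _ ≤ ∫⁻ t, (ENNReal.ofReal (2 * Real.exp |y|) * gaussianPDF 0 1 y) *
          (ENNReal.ofReal (|t| ^ κ) * scaledDensity π₀ τ t) := setLIntegral_le_lintegral _ _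
    _ = (ENNReal.ofReal (2 * Real.exp |y|) * gaussianPDF 0 1 y) *
          ∫⁻ t, ENNReal.ofReal (|t| ^ κ) * scaledDensity π₀ τ t := by
        rw [lintegral_const_mul' _ _ (ENNReal.mul_ne_top ENNReal.ofReal_ne_top
          ((gaussianPDF_one_le_one 0 y).trans_lt ENNReal.one_lt_top).ne)]
    _ ≤ (ENNReal.ofReal (2 * Real.exp |y|) * (ENNReal.ofReal (c * Real.exp |y|) * m)) *
          ENNReal.ofReal (D * τ ^ κ) := mul_le_mul' (mul_le_mul' le_rfl hφ) hmom
    _ = ENNReal.ofReal (τ ^ κ * (2 * D * c * (Real.exp |y| * Real.exp |y|))) * m := by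
        rw [mul_comm, ← mul_assoc, ← mul_assoc, ← ENNReal.ofReal_mul (by positivity),
          ← ENNReal.ofReal_mul (by positivity)]
        congr 2
        ring

/-- With the prior density at most `B`, only a Gaussian second moment remains. Measuring it in units
of the marginal costs `exp (y²/2 + |y|)`, so the bound is useful for moderate `y` only: that factor
is not integrable under `N(0,1)`. -/
theorem lintegral_one_lt_abs_le {π₀ : ℝ → ℝ} {B c τ y : ℝ} (hB : 0 < B)
    (hb : ∀ t : ℝ, 1 < |t| → scaledDensity π₀ τ t ≤ ENNReal.ofReal B)
    (hφ : gaussianPDF 0 1 y ≤ ENNReal.ofReal (c * Real.exp |y|) * marginalDensity π₀ τ y) :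
    ∫⁻ t in {t : ℝ | |t| ≤ 1}ᶜ,
      ENNReal.ofReal (|t| + t ^ 2) * (gaussianPDF t 1 y * scaledDensity π₀ τ t) ≤
      ENNReal.ofReal (4 * B * √(2 * Real.pi) * c * (1 + y ^ 2) * Real.exp (y ^ 2 / 2 + |y|)) *
        marginalDensity π₀ τ y := by
  have hms : MeasurableSet {t : ℝ | |t| ≤ 1} :=
    measurableSet_le measurable_norm measurable_const
  set m := marginalDensity π₀ τ y with hm
  have hpt : ∀ t : ℝ, 1 < |t| →
      ENNReal.ofReal (|t| + t ^ 2) * (gaussianPDF t 1 y * scaledDensity π₀ τ t) ≤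
      ENNReal.ofReal (2 * B) * (ENNReal.ofReal (t ^ 2) * gaussianPDF t 1 y) := by
    intro t ht1
    calc _ ≤ ENNReal.ofReal (2 * t ^ 2) * (gaussianPDF t 1 y * ENNReal.ofReal B) :=
          mul_le_mul' (ENNReal.ofReal_le_ofReal (abs_add_sq_le_two_mul_sq ht1))
            (mul_le_mul' le_rfl (hb t ht1))
      _ = _ := by
        rw [ENNReal.ofReal_mul zero_le_two, ENNReal.ofReal_mul zero_le_two]
        ring
  calc _ ≤ ∫⁻ t in {t : ℝ | |t| ≤ 1}ᶜ, ENNReal.ofReal (2 * B) *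
          (ENNReal.ofReal (t ^ 2) * gaussianPDF t 1 y) :=
        setLIntegral_mono' hms.compl fun t ht => hpt t (by simpa using ht)
    _ ≤ ∫⁻ t, ENNReal.ofReal (2 * B) *
          (ENNReal.ofReal (t ^ 2) * gaussianPDF t 1 y) := setLIntegral_le_lintegral _ _
    _ = ENNReal.ofReal (2 * B) * ∫⁻ t, ENNReal.ofReal (t ^ 2) * gaussianPDF t 1 y := by
        rw [lintegral_const_mul' _ _ ENNReal.ofReal_ne_top]
    _ ≤ ENNReal.ofReal (2 * B) * ENNReal.ofReal (2 * (1 + y ^ 2)) * 1 := by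
        rw [mul_one]
        exact mul_le_mul' le_rfl (lintegral_sq_mul_gaussianPDF_le y)
    -- The trailing factor 1 is rewritten as `√(2π) exp(y²/2)` times the noise density, to which
    -- `hφ` applies.
    _ ≤ ENNReal.ofReal (2 * B) * ENNReal.ofReal (2 * (1 + y ^ 2)) *
          (ENNReal.ofReal (√(2 * Real.pi) * Real.exp (y ^ 2 / 2)) *
            (ENNReal.ofReal (c * Real.exp |y|) * m)) := by
        refine mul_le_mul' le_rfl ((one_eq_mul_gaussianPDF y).le.trans (mul_le_mul' le_rfl hφ))
    _ = _ := by
        rw [← mul_assoc, ← mul_assoc, ← ENNReal.ofReal_mul (by positivity),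
          ← ENNReal.ofReal_mul (by positivity), ← ENNReal.ofReal_mul (by positivity),
          Real.exp_add]
        congr 2
        ring

namespace IsPolynomialTailDensity

variable {π₀ : ℝ → ℝ} {α : ℝ}

theorem measurable_marginalDensity_prod (h : IsPolynomialTailDensity π₀ α) :
    Measurable fun q : ℝ × ℝ => marginalDensity π₀ q.1 q.2 := by
  unfold marginalDensity
  refine Measurable.lintegral_prod_right' (f := fun z : (ℝ × ℝ) × ℝ =>
    gaussianPDF z.2 1 z.1.2 * scaledDensity π₀ z.1.1 z.2) ?_
  have h1 : Measurable fun z : (ℝ × ℝ) × ℝ => (z.2, z.1.2) := by fun_prop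
  have h2 : Measurable fun z : (ℝ × ℝ) × ℝ => (z.1.1, z.2) := by fun_prop
  exact (measurable_gaussianPDF_one_prod.comp h1).mul (h.measurable_scaledDensity_prod.comp h2)

theorem measurable_marginalDensity (h : IsPolynomialTailDensity π₀ α) (τ : ℝ) :
    Measurable (marginalDensity π₀ τ) :=
  Measurable.comp (g := fun q : ℝ × ℝ => marginalDensity π₀ q.1 q.2)
    h.measurable_marginalDensity_prod (f := fun y => (τ, y)) (by fun_prop)

theorem measurable_marginalDensity_left (h : IsPolynomialTailDensity π₀ α) (y : ℝ) :
    Measurable fun τ => marginalDensity π₀ τ y :=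
  Measurable.comp (g := fun q : ℝ × ℝ => marginalDensity π₀ q.1 q.2)
    h.measurable_marginalDensity_prod (f := fun τ => (τ, y)) (by fun_prop)

theorem measurable_integrand (h : IsPolynomialTailDensity π₀ α) (τ y : ℝ) :
    Measurable fun t => gaussianPDF t 1 y * scaledDensity π₀ τ t :=
  (measurable_gaussianPDF_one_left y).mul (h.measurable_scaledDensity τ)

theorem le_marginalDensity_of_abs_le (h : IsPolynomialTailDensity π₀ α) (τ y : ℝ) (δ : ℝ) :
    gaussianPDF 0 1 y * ENNReal.ofReal (Real.exp (-(|y| * δ + δ ^ 2 / 2))) *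
      ∫⁻ x in {x : ℝ | |x| ≤ δ}, scaledDensity π₀ τ x ≤ marginalDensity π₀ τ y := by
  have hms : MeasurableSet {x : ℝ | |x| ≤ δ} := measurableSet_le measurable_norm measurable_const
  rw [← lintegral_const_mul _ (h.measurable_scaledDensity τ)]
  refine le_trans ?_ (setLIntegral_le_lintegral {x : ℝ | |x| ≤ δ} _)
  refine setLIntegral_mono' hms fun t ht => ?_
  rw [gaussianPDF_one_eq_zero_mul t y]
  gcongr
  have ht' : |t| ≤ δ := ht
  have h1 : -(|y| * δ) ≤ y * t := by
    have := neg_abs_le (y * t)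
    rw [abs_mul] at this
    have h2 : |y| * |t| ≤ |y| * δ := by gcongr
    linarith
  have h2 : t ^ 2 ≤ δ ^ 2 := by
    rw [← sq_abs t]
    gcongr
  linarith

/-- A small scale puts at least half of the prior mass in `[-1, 1]`, where the likelihood is at
least `exp (-(|y| + 1/2))` times its value at 0. -/
theorem exists_gaussianPDF_le_marginalDensity (h : IsPolynomialTailDensity π₀ α) (hα : 1 < α) :
    ∃ t₀ c : ℝ, 0 < t₀ ∧ 0 < c ∧ ∀ τ y : ℝ, 0 < τ → τ ≤ t₀ →
      gaussianPDF 0 1 y ≤ ENNReal.ofReal (c * Real.exp |y|) * marginalDensity π₀ τ y := by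
  obtain ⟨M, C, hM, hC, hb⟩ := h.exists_one_le_lintegral_abs_le hα
  have h1 : 0 < α - 1 := by linarith
  have hlim : ∀ᶠ τ in 𝓝[>] (0 : ℝ), C * τ ^ (α - 1) < 1 / 2 := by
    have : Tendsto (fun τ : ℝ => C * τ ^ (α - 1)) (𝓝 0) (𝓝 0) := by
      have h2 : ContinuousAt (fun τ : ℝ => C * τ ^ (α - 1)) 0 :=
        continuousAt_const.mul (Real.continuousAt_rpow_const _ _ (Or.inr h1.le))
      have h3 := h2.tendsto
      simpa [Real.zero_rpow h1.ne'] using h3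
    exact (this.mono_left nhdsWithin_le_nhds).eventually_lt_const (by norm_num)
  obtain ⟨t₁, ht₁, hτ₁⟩ := mem_nhdsGT_iff_exists_Ioc_subset.1 hlim
  refine ⟨min t₁ (1 / M), 2 * Real.exp (1 / 2), lt_min ht₁ (by positivity), by positivity,
    fun τ y hτ hτ' => ?_⟩
  have hmass := hb τ 1 hτ one_pos (by
    have := hτ'.trans (min_le_right _ _)
    rw [le_div_iff₀ hM] at this
    linarith)
  have hsmall : C * τ ^ (α - 1) < 1 / 2 := hτ₁ ⟨hτ, hτ'.trans (min_le_left _ _)⟩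
  rw [div_one] at hmass
  have hhalf : ENNReal.ofReal (1 / 2) ≤ ∫⁻ x in {x : ℝ | |x| ≤ 1}, scaledDensity π₀ τ x := by
    have h2 : ENNReal.ofReal (1 / 2) + ENNReal.ofReal (1 / 2) ≤
        (∫⁻ x in {x : ℝ | |x| ≤ 1}, scaledDensity π₀ τ x) + ENNReal.ofReal (1 / 2) := by
      rw [← ENNReal.ofReal_add (by norm_num) (by norm_num)]
      norm_num
      refine hmass.trans ?_
      gcongr
    exact (ENNReal.add_le_add_iff_right ENNReal.ofReal_ne_top).1 h2
  refine le_trans ?_ (mul_le_mul_right (h.le_marginalDensity_of_abs_le τ y 1) _)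
  calc gaussianPDF 0 1 y
      = ENNReal.ofReal (2 * Real.exp (1 / 2) * Real.exp |y|) *
        (gaussianPDF 0 1 y * ENNReal.ofReal (Real.exp (-(|y| * 1 + 1 ^ 2 / 2))) *
          ENNReal.ofReal (1 / 2)) := by
        rw [mul_assoc (gaussianPDF 0 1 y), mul_left_comm, ← ENNReal.ofReal_mul (by positivity),
          ← ENNReal.ofReal_mul (by positivity)]
        have : 2 * Real.exp (1 / 2) * Real.exp |y| *
            (Real.exp (-(|y| * 1 + 1 ^ 2 / 2)) * (1 / 2)) = 1 := by
          have h3 : Real.exp (1 / 2) * Real.exp |y| * Real.exp (-(|y| * 1 + 1 ^ 2 / 2)) = 1 := by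
            rw [← Real.exp_add, ← Real.exp_add, Real.exp_eq_one_iff]
            ring
          linarith
        rw [this, ENNReal.ofReal_one, mul_one]
    _ ≤ _ := by gcongr

/-- Where `|t| ≤ 8 |y|` the weight is at most `64 y²`. Further out, substitute `t = 2 v`: by
unimodality the prior density at `2 v` is at most that at `v`, and the Gaussian loss in passing from
`v` to `2 v` absorbs the factor `v²`. The bound holds for every positive scale. -/
theorem lintegral_sq_mul_le (h : IsPolynomialTailDensity π₀ α) {τ : ℝ} (hτ : 0 < τ) (y : ℝ) :
    ∫⁻ t, ENNReal.ofReal (t ^ 2) * (gaussianPDF t 1 y * scaledDensity π₀ τ t) ≤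
      ENNReal.ofReal (64 * (1 + y ^ 2)) * marginalDensity π₀ τ y := by
  have hms : MeasurableSet {t : ℝ | |t| ≤ 8 * |y|} :=
    measurableSet_le measurable_norm measurable_const
  have hg := h.measurable_integrand τ y
  rw [← lintegral_add_compl _ hms]
  have hnear : ∫⁻ t in {t : ℝ | |t| ≤ 8 * |y|},
      ENNReal.ofReal (t ^ 2) * (gaussianPDF t 1 y * scaledDensity π₀ τ t) ≤
      ENNReal.ofReal (64 * y ^ 2) * marginalDensity π₀ τ y := by
    rw [marginalDensity, ← lintegral_const_mul _ hg]
    refine le_trans ?_ (setLIntegral_le_lintegral {t : ℝ | |t| ≤ 8 * |y|} _)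
    refine setLIntegral_mono' hms fun t ht => ?_
    gcongr
    have ht' : |t| ≤ 8 * |y| := ht
    rw [← sq_abs t, ← sq_abs y]
    nlinarith [abs_nonneg t, abs_nonneg y]
  have hfar : ∫⁻ t in {t : ℝ | |t| ≤ 8 * |y|}ᶜ,
      ENNReal.ofReal (t ^ 2) * (gaussianPDF t 1 y * scaledDensity π₀ τ t) ≤
      ENNReal.ofReal 8 * marginalDensity π₀ τ y := by
    set F : ℝ → ℝ≥0∞ := {t : ℝ | |t| ≤ 8 * |y|}ᶜ.indicator fun t =>
      ENNReal.ofReal (t ^ 2) * (gaussianPDF t 1 y * scaledDensity π₀ τ (t / 2)) with hF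
    have hFm : Measurable F := by
      refine Measurable.indicator ?_ hms.compl
      have h1 : Measurable fun t : ℝ => scaledDensity π₀ τ (t / 2) :=
        (h.measurable_scaledDensity τ).comp (by fun_prop)
      have := (measurable_gaussianPDF_one_left y).mul h1
      fun_prop
    calc _ ≤ ∫⁻ t, F t := by
          rw [hF, lintegral_indicator hms.compl]
          refine setLIntegral_mono' hms.compl fun t ht => ?_
          have ht' : 8 * |y| < |t| := by simpa using ht
          gcongr
          exact h.scaledDensity_le_half hτ (abs_pos.1 (lt_of_le_of_lt (by positivity) ht'))
      _ = ENNReal.ofReal 2 * ∫⁻ v, F (2 * v) := lintegral_comp_const_mul hFm two_pos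
      _ ≤ ENNReal.ofReal 2 * ∫⁻ v, ENNReal.ofReal 4 *
            (gaussianPDF v 1 y * scaledDensity π₀ τ v) := by
          gcongr with v
          by_cases hv : 2 * v ∈ {t : ℝ | |t| ≤ 8 * |y|}ᶜ
          · rw [hF, indicator_of_mem hv, mul_div_cancel_left₀ v two_ne_zero, ← mul_assoc,
              ← mul_assoc, gaussianPDF_one_eq, gaussianPDF_one_eq, ← ENNReal.ofReal_mul (by positivity),
              ← ENNReal.ofReal_mul (by positivity)]
            gcongr ENNReal.ofReal ?_ * _
            have hv' : 8 * |y| < |2 * v| := by simpa using hv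
            rw [abs_mul, abs_two] at hv'
            -- Here `|y| < |v| / 4`. The exponents below compare once `y v ≤ v²/2`, so this
            -- suffices.
            have h1 : y * v ≤ v ^ 2 / 4 := by
              refine (le_abs_self _).trans ?_
              rw [abs_mul, ← sq_abs v]
              nlinarith [abs_nonneg v]
            have h2 : v ^ 2 * Real.exp (-(y - 2 * v) ^ 2 / 2) ≤ Real.exp (-(y - v) ^ 2 / 2) := by
              calc v ^ 2 * Real.exp (-(y - 2 * v) ^ 2 / 2)
                  ≤ Real.exp (v ^ 2) * Real.exp (-(y - 2 * v) ^ 2 / 2) := by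
                    gcongr
                    linarith [Real.add_one_le_exp (v ^ 2)]
                _ ≤ _ := by
                    rw [← Real.exp_add]
                    gcongr
                    nlinarith
            calc (2 * v) ^ 2 * ((√(2 * Real.pi))⁻¹ * Real.exp (-(y - 2 * v) ^ 2 / 2))
                = 4 * ((√(2 * Real.pi))⁻¹ * (v ^ 2 * Real.exp (-(y - 2 * v) ^ 2 / 2))) := by ring
              _ ≤ _ := by gcongr
          · rw [hF, indicator_of_notMem hv]
            exact zero_le
      _ = ENNReal.ofReal 8 * marginalDensity π₀ τ y := by
          rw [lintegral_const_mul _ hg, ← mul_assoc, ← ENNReal.ofReal_mul (by norm_num)]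
          norm_num [marginalDensity]
  refine (add_le_add hnear hfar).trans ?_
  rw [← add_mul, ← ENNReal.ofReal_add (by positivity) (by positivity)]
  gcongr
  linarith

/-- Polynomial in `y` but with no gain from a small `τ`: the counterpart, for large `y`, of
`lintegral_one_lt_abs_le`. -/
theorem lintegral_one_lt_abs_le_of_unimodal (h : IsPolynomialTailDensity π₀ α) {τ : ℝ} (hτ : 0 < τ)
    (y : ℝ) :
    ∫⁻ t in {t : ℝ | |t| ≤ 1}ᶜ,
      ENNReal.ofReal (|t| + t ^ 2) * (gaussianPDF t 1 y * scaledDensity π₀ τ t) ≤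
      ENNReal.ofReal (128 * (1 + y ^ 2)) * marginalDensity π₀ τ y := by
  have hms : MeasurableSet {t : ℝ | |t| ≤ 1} :=
    measurableSet_le measurable_norm measurable_const
  calc _ ≤ ∫⁻ t in {t : ℝ | |t| ≤ 1}ᶜ, ENNReal.ofReal 2 *
          (ENNReal.ofReal (t ^ 2) * (gaussianPDF t 1 y * scaledDensity π₀ τ t)) := by
        refine setLIntegral_mono' hms.compl fun t ht => ?_
        rw [← mul_assoc (ENNReal.ofReal 2), ← ENNReal.ofReal_mul zero_le_two]
        exact mul_le_mul' (ENNReal.ofReal_le_ofReal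
          (abs_add_sq_le_two_mul_sq (by simpa using ht))) le_rfl
    _ ≤ ∫⁻ t, ENNReal.ofReal 2 *
          (ENNReal.ofReal (t ^ 2) * (gaussianPDF t 1 y * scaledDensity π₀ τ t)) :=
        setLIntegral_le_lintegral _ _
    _ = ENNReal.ofReal 2 * ∫⁻ t,
          ENNReal.ofReal (t ^ 2) * (gaussianPDF t 1 y * scaledDensity π₀ τ t) := by
        rw [lintegral_const_mul' _ _ ENNReal.ofReal_ne_top]
    _ ≤ ENNReal.ofReal 2 * (ENNReal.ofReal (64 * (1 + y ^ 2)) * marginalDensity π₀ τ y) :=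
        mul_le_mul' le_rfl (h.lintegral_sq_mul_le hτ y)
    _ = _ := by
        rw [← mul_assoc, ← ENNReal.ofReal_mul zero_le_two]
        congr 2
        ring

/-- Posterior moment bound at a null coordinate, uniformly over small scales. -/
theorem exists_lintegral_abs_add_sq_le (h : IsPolynomialTailDensity π₀ α) (hα : 1 < α) :
    ∃ A b r₀ : ℝ, 0 < A ∧ 0 < b ∧ b < 1 / 2 ∧ 0 < r₀ ∧ ∀ r τ y : ℝ, 0 < r → r ≤ r₀ → 0 < τ →
      τ ≤ r ^ (α / (α - 1)) →
      ∫⁻ t, ENNReal.ofReal (|t| + t ^ 2) * (gaussianPDF t 1 y * scaledDensity π₀ τ t) ≤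
        ENNReal.ofReal (r * (A * Real.exp (b * y ^ 2))) * marginalDensity π₀ τ y := by
  have hα1 : 0 < α - 1 := by linarith
  have hα0 : 0 < α := by linarith
  -- This exponent makes `τ ≤ r^(α/(α-1))` give exactly `τ ^ κ ≤ r`, and `α > 1` yields both `κ ≤ 1`
  -- and `κ < α - 1`.
  set κ := (α - 1) / α with hκ
  have hκ0 : 0 < κ := by positivity
  have hκ1 : κ ≤ 1 := by rw [hκ, div_le_one hα0]; linarith
  have hκα : κ < α - 1 := by rw [hκ, div_lt_iff₀ hα0]; nlinarith
  obtain ⟨D, hD, hmom⟩ := h.exists_lintegral_rpow_abs_le hκ0 hκα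
  obtain ⟨t₀, c, ht₀, hc, hphi⟩ := h.exists_gaussianPDF_le_marginalDensity hα
  obtain ⟨M, C₁, C₂, hM, -, hC₂, hb⟩ := h.exists_scaledDensity_bounds
  -- With this choice `b = 1/(2α) + 2 η` is the midpoint of `1/(2α)` and `1/2`.
  set η := (1 - 1 / α) / 8 with hη
  have hα' : 1 / α < 1 := by rw [div_lt_one hα0]; exact hα
  have hα'0 : 0 < 1 / α := by positivity
  have hη0 : 0 < η := by rw [hη]; linarith
  have hη1 : η ≤ 1 := by rw [hη]; linarith
  set K := max (4 * C₂ * √(2 * Real.pi) * c) 128 with hK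
  have hK0 : 0 < K := lt_of_lt_of_le (by norm_num) (le_max_right _ _)
  set b := 1 / α / 2 + 2 * η with hbdef
  have hm0 : 0 < min t₀ (1 / M) := by positivity
  refine ⟨2 * D * c * Real.exp (1 / η) + K * (1 / η * Real.exp (1 / η)), b,
    (min t₀ (1 / M)) ^ ((α - 1) / α), by positivity, by positivity, by
      rw [hbdef, hη]; linarith, by positivity, fun r τ y hr hr₀ hτ hτr => ?_⟩
  have hτt : τ ≤ min t₀ (1 / M) := by
    refine hτr.trans ?_
    calc r ^ (α / (α - 1)) ≤ ((min t₀ (1 / M)) ^ ((α - 1) / α)) ^ (α / (α - 1)) := by gcongr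
      _ = min t₀ (1 / M) := by
          rw [← Real.rpow_mul hm0.le, div_mul_div_cancel₀ hα0.ne', div_self hα1.ne', Real.rpow_one]
  have hτκ : τ ^ κ ≤ r := by
    calc τ ^ κ ≤ (r ^ (α / (α - 1))) ^ κ := by gcongr
      _ = r := by
        rw [← Real.rpow_mul hr.le, hκ, div_mul_div_cancel₀ hα1.ne', div_self hα0.ne', Real.rpow_one]
  have hτα : τ ^ (α - 1) ≤ r ^ α := by
    calc τ ^ (α - 1) ≤ (r ^ (α / (α - 1))) ^ (α - 1) := by gcongr
      _ = r ^ α := by rw [← Real.rpow_mul hr.le, div_mul_cancel₀ _ hα1.ne']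
  have hMτ : M * τ ≤ 1 := by
    have := hτt.trans (min_le_right _ _)
    rw [le_div_iff₀ hM] at this
    linarith
  have hφ := hphi τ y hτ (hτt.trans (min_le_left _ _))
  have hbody := lintegral_abs_le_one_le hκ0 hκ1 hD hτ (hmom τ hτ) hφ
  have hX := lintegral_one_lt_abs_le (B := C₂ * r ^ α) (by positivity) (fun t ht => by
    refine (hb τ t hτ (lt_of_le_of_lt hMτ ht)).2.trans (ENNReal.ofReal_le_ofReal ?_)
    have e3 : |t| ^ (-α) ≤ 1 := Real.rpow_le_one_of_one_le_of_nonpos ht.le (by linarith)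
    calc C₂ * τ ^ (α - 1) * |t| ^ (-α) ≤ C₂ * r ^ α * 1 := by gcongr
      _ = _ := mul_one _) hφ
  have hY := h.lintegral_one_lt_abs_le_of_unimodal hτ y
  set m := marginalDensity π₀ τ y with hm
  have hbody' := hbody.trans (mul_le_mul' (ENNReal.ofReal_le_ofReal (q :=
      r * (2 * D * c * (Real.exp (1 / η) * Real.exp (b * y ^ 2)))) (by
    have e : Real.exp |y| * Real.exp |y| ≤ Real.exp (1 / η) * Real.exp (b * y ^ 2) := by
      rw [← Real.exp_add, ← Real.exp_add]
      apply Real.exp_le_exp.2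
      have := two_mul_abs_le hη0 y
      rw [hbdef]
      nlinarith [sq_nonneg y]
    gcongr)) le_rfl)
  -- Both bounds for `|t| > 1` hold at every `y`; their minimum is then interpolated by
  -- `one_add_sq_mul_min_le`.
  have hfar : ∫⁻ t in {t : ℝ | |t| ≤ 1}ᶜ,
      ENNReal.ofReal (|t| + t ^ 2) * (gaussianPDF t 1 y * scaledDensity π₀ τ t) ≤
      ENNReal.ofReal (K * ((1 + y ^ 2) * min (r ^ α * Real.exp (y ^ 2 / 2 + |y|)) 1)) * m := by
    rcases min_choice (r ^ α * Real.exp (y ^ 2 / 2 + |y|)) 1 with e | e <;> rw [e]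
    · refine hX.trans (mul_le_mul' (ENNReal.ofReal_le_ofReal ?_) le_rfl)
      calc _ = (4 * C₂ * √(2 * Real.pi) * c) *
            ((1 + y ^ 2) * (r ^ α * Real.exp (y ^ 2 / 2 + |y|))) := by ring
        _ ≤ _ := mul_le_mul_of_nonneg_right (le_max_left _ _) (by positivity)
    · refine hY.trans (mul_le_mul' (ENNReal.ofReal_le_ofReal ?_) le_rfl)
      rw [mul_one]
      exact mul_le_mul_of_nonneg_right (le_max_right _ _) (by positivity)
  have hfar' := hfar.trans (mul_le_mul' (ENNReal.ofReal_le_ofReal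
    (mul_le_mul_of_nonneg_left (one_add_sq_mul_min_le hα hη0 hη1 hr y) hK0.le)) le_rfl)
  have hms : MeasurableSet {t : ℝ | |t| ≤ 1} :=
    measurableSet_le measurable_norm measurable_const
  rw [← lintegral_add_compl _ hms]
  refine (add_le_add hbody' hfar').trans_eq ?_
  rw [← add_mul, ← ENNReal.ofReal_add (by positivity) (by positivity)]
  congr 2
  ring

end IsPolynomialTailDensity

/-! ### Bounding the posterior probability and its expectation -/

/-- The mass, on scales in `U`, of the likelihood ratio of the null coordinates against pure
noise. -/
noncomputable def nullRatio (π₀ : ℝ → ℝ) (ν : Measure ℝ) {n : ℕ} (S : Finset (Fin n)) (U : Set ℝ)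
    (y : Fin n → ℝ) : ℝ≥0∞ :=
  ∫⁻ τ in U, ∏ i ∈ Sᶜ, marginalDensity π₀ τ (y i) / gaussianPDF 0 1 (y i) ∂ν

theorem gaussianPDF_one_ne_top (t y : ℝ) : gaussianPDF t 1 y ≠ ⊤ :=
  ((gaussianPDF_one_le_one t y).trans_lt ENNReal.one_lt_top).ne

/-- No positivity of the denominator is needed, since a quotient by 0 or `⊤` of a smaller quantity
cannot exceed 1 under the `ℝ≥0∞` conventions. -/
theorem posteriorProb_le_one (π₀ : ℝ → ℝ) (ν : Measure ℝ) {n : ℕ} (y : Fin n → ℝ)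
    (A : Set (Fin n → ℝ)) : posteriorProb π₀ ν y A ≤ 1 :=
  ENNReal.div_le_of_le_mul (by rw [one_mul]; exact setLIntegral_le_lintegral _ _)

namespace IsPolynomialTailDensity

variable {π₀ : ℝ → ℝ} {α : ℝ} {n : ℕ}

theorem measurable_prod_integrand (h : IsPolynomialTailDensity π₀ α) (y : Fin n → ℝ) :
    Measurable fun q : (Fin n → ℝ) × ℝ =>
      ∏ i, gaussianPDF (q.1 i) 1 (y i) * scaledDensity π₀ q.2 (q.1 i) := by
  refine Finset.measurable_prod _ fun i _ => ?_
  have h1 : Measurable fun q : (Fin n → ℝ) × ℝ => q.1 i := by fun_prop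
  have h2 : Measurable fun q : (Fin n → ℝ) × ℝ => (q.2, q.1 i) := by fun_prop
  exact ((measurable_gaussianPDF_one_left (y i)).comp h1).mul
    (h.measurable_scaledDensity_prod.comp h2)

theorem setLIntegral_likelihood_mul_priorDensity (h : IsPolynomialTailDensity π₀ α)
    (ν : Measure ℝ) [SFinite ν] (y : Fin n → ℝ) (A : Set (Fin n → ℝ)) :
    ∫⁻ θ in A, likelihood θ y * priorDensity π₀ ν θ =
      ∫⁻ τ, (∫⁻ θ in A, ∏ i, gaussianPDF (θ i) 1 (y i) * scaledDensity π₀ τ (θ i)) ∂ν := by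
  rw [← lintegral_lintegral_swap (h.measurable_prod_integrand y).aemeasurable]
  refine lintegral_congr fun θ => ?_
  simp_rw [Finset.prod_mul_distrib]
  rw [lintegral_const_mul' _ _ (ENNReal.prod_ne_top fun i _ => gaussianPDF_one_ne_top _ _)]
  rfl

theorem lintegral_prod_integrand (h : IsPolynomialTailDensity π₀ α) (τ : ℝ) (y : Fin n → ℝ) :
    ∫⁻ θ : Fin n → ℝ, ∏ i, gaussianPDF (θ i) 1 (y i) * scaledDensity π₀ τ (θ i) =
      ∏ i, marginalDensity π₀ τ (y i) :=
  lintegral_pi_prod (f := fun i t => gaussianPDF t 1 (y i) * scaledDensity π₀ τ t)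
    fun i => h.measurable_integrand τ (y i)

theorem lintegral_likelihood_mul_priorDensity (h : IsPolynomialTailDensity π₀ α)
    (ν : Measure ℝ) [SFinite ν] (y : Fin n → ℝ) :
    ∫⁻ θ, likelihood θ y * priorDensity π₀ ν θ = ∫⁻ τ, ∏ i, marginalDensity π₀ τ (y i) ∂ν := by
  have := h.setLIntegral_likelihood_mul_priorDensity ν y univ
  simp only [Measure.restrict_univ, h.lintegral_prod_integrand] at this
  exact this

theorem marginalDensity_le_one (h : IsPolynomialTailDensity π₀ α) {τ : ℝ} (hτ : 0 < τ) (y : ℝ) :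
    marginalDensity π₀ τ y ≤ 1 := by
  rw [← h.lintegral_scaledDensity hτ]
  refine lintegral_mono fun t => ?_
  exact mul_le_of_le_one_left zero_le (gaussianPDF_one_le_one _ _)

theorem prod_marginalDensity_le (h : IsPolynomialTailDensity π₀ α) {τ : ℝ} (hτ : 0 < τ)
    (y : Fin n → ℝ) (S : Finset (Fin n)) :
    ∏ i, marginalDensity π₀ τ (y i) ≤ ∏ i ∈ Sᶜ, marginalDensity π₀ τ (y i) := by
  rw [← Finset.prod_mul_prod_compl S]
  exact mul_le_of_le_one_left zero_le
    (Finset.prod_le_one' fun i _ => h.marginalDensity_le_one hτ _)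

/-- Markov's inequality for the unnormalised posterior at fixed `τ`. As this factorises, weighting
by a function of coordinate `i` alters only the `i`-th marginal factor. -/
theorem setLIntegral_null_le (h : IsPolynomialTailDensity π₀ α) (τ : ℝ) (y : Fin n → ℝ)
    (N : Finset (Fin n)) {κ : ℝ} (hκ : 0 < κ) (g : Fin n → ℝ≥0∞)
    (hg : ∀ i ∈ N, ∫⁻ t, ENNReal.ofReal (|t| + t ^ 2) *
      (gaussianPDF t 1 (y i) * scaledDensity π₀ τ t) ≤ g i * marginalDensity π₀ τ (y i)) :
    ∫⁻ θ in {θ : Fin n → ℝ | κ ≤ ∑ i ∈ N, (|θ i| + θ i ^ 2)},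
      ∏ i, gaussianPDF (θ i) 1 (y i) * scaledDensity π₀ τ (θ i) ≤
      (ENNReal.ofReal κ)⁻¹ * (∑ i ∈ N, g i) * ∏ i, marginalDensity π₀ τ (y i) := by
  have hms : MeasurableSet {θ : Fin n → ℝ | κ ≤ ∑ i ∈ N, (|θ i| + θ i ^ 2)} :=
    measurableSet_le measurable_const (by fun_prop)
  have hκ' : ENNReal.ofReal κ ≠ 0 := by simpa using hκ
  have hF : ∀ i : Fin n, Measurable fun θ : Fin n → ℝ =>
      gaussianPDF (θ i) 1 (y i) * scaledDensity π₀ τ (θ i) := fun i =>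
    (h.measurable_integrand τ (y i)).comp (measurable_pi_apply i)
  have hone : ∀ i ∈ N, ∫⁻ θ : Fin n → ℝ, ENNReal.ofReal (|θ i| + θ i ^ 2) *
      ∏ j, gaussianPDF (θ j) 1 (y j) * scaledDensity π₀ τ (θ j) ≤
      g i * ∏ j, marginalDensity π₀ τ (y j) := by
    intro i hi
    set k : Fin n → ℝ → ℝ≥0∞ := fun j t => (if j = i then ENNReal.ofReal (|t| + t ^ 2) else 1) *
      (gaussianPDF t 1 (y j) * scaledDensity π₀ τ t) with hk
    have hkm : ∀ j, Measurable (k j) := by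
      intro j
      refine Measurable.mul ?_ (h.measurable_integrand τ (y j))
      split_ifs <;> fun_prop
    have e1 : ∀ θ : Fin n → ℝ, ENNReal.ofReal (|θ i| + θ i ^ 2) *
        ∏ j, gaussianPDF (θ j) 1 (y j) * scaledDensity π₀ τ (θ j) = ∏ j, k j (θ j) := by
      intro θ
      rw [hk, Finset.prod_mul_distrib (f := fun j => if j = i then
        ENNReal.ofReal (|θ j| + θ j ^ 2) else 1), Finset.prod_ite_eq']
      simp
    simp_rw [e1]
    refine (lintegral_pi_prod hkm).trans_le ?_
    rw [← Finset.mul_prod_erase _ _ (Finset.mem_univ i),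
      ← Finset.mul_prod_erase _ (fun j => marginalDensity π₀ τ (y j)) (Finset.mem_univ i),
      ← mul_assoc]
    refine mul_le_mul' ?_ (le_of_eq (Finset.prod_congr rfl fun j hj => ?_))
    · simpa [hk] using hg i hi
    · simp [hk, (Finset.mem_erase.1 hj).1, marginalDensity]
  calc _ ≤ ∫⁻ θ in {θ : Fin n → ℝ | κ ≤ ∑ i ∈ N, (|θ i| + θ i ^ 2)},
          (ENNReal.ofReal κ)⁻¹ * ∑ i ∈ N, ENNReal.ofReal (|θ i| + θ i ^ 2) *
          ∏ j, gaussianPDF (θ j) 1 (y j) * scaledDensity π₀ τ (θ j) := by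
        refine setLIntegral_mono' hms fun θ hθ => ?_
        rw [← Finset.sum_mul, ← mul_assoc]
        refine le_mul_of_one_le_left zero_le ?_
        rw [← ENNReal.ofReal_sum_of_nonneg fun i _ => by positivity,
          ← ENNReal.inv_mul_cancel hκ' ENNReal.ofReal_ne_top]
        exact mul_le_mul' le_rfl (ENNReal.ofReal_le_ofReal hθ)
    _ ≤ ∫⁻ θ : Fin n → ℝ,
          (ENNReal.ofReal κ)⁻¹ * ∑ i ∈ N, ENNReal.ofReal (|θ i| + θ i ^ 2) *
          ∏ j, gaussianPDF (θ j) 1 (y j) * scaledDensity π₀ τ (θ j) :=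
        setLIntegral_le_lintegral _ _
    _ = (ENNReal.ofReal κ)⁻¹ * ∑ i ∈ N, ∫⁻ θ : Fin n → ℝ, ENNReal.ofReal (|θ i| + θ i ^ 2) *
          ∏ j, gaussianPDF (θ j) 1 (y j) * scaledDensity π₀ τ (θ j) := by
        rw [lintegral_const_mul' _ _ (ENNReal.inv_ne_top.2 hκ'), lintegral_finsetSum]
        intro i _
        exact Measurable.mul (by fun_prop) (Finset.measurable_prod _ fun j _ => hF j)
    _ ≤ (ENNReal.ofReal κ)⁻¹ * ∑ i ∈ N, g i * ∏ j, marginalDensity π₀ τ (y j) :=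
        mul_le_mul' le_rfl (Finset.sum_le_sum hone)
    _ = _ := by rw [← Finset.sum_mul, mul_assoc]

/-- The likelihood on `S` is uniformly at most `exp (-E)` on this set. Once it is pulled out, the
prior on `S` integrates to 1 and no volume of the set enters. -/
theorem setLIntegral_signal_le (h : IsPolynomialTailDensity π₀ α) {τ : ℝ} (hτ : 0 < τ)
    (y : Fin n → ℝ) (S : Finset (Fin n)) (E : ℝ) :
    ∫⁻ θ in {θ : Fin n → ℝ | 2 * E ≤ ∑ i ∈ S, (y i - θ i) ^ 2},
      ∏ i, gaussianPDF (θ i) 1 (y i) * scaledDensity π₀ τ (θ i) ≤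
      ENNReal.ofReal (Real.exp (-E)) * ∏ i ∈ Sᶜ, marginalDensity π₀ τ (y i) := by
  have hms : MeasurableSet {θ : Fin n → ℝ | 2 * E ≤ ∑ i ∈ S, (y i - θ i) ^ 2} :=
    measurableSet_le measurable_const (by fun_prop)
  set k : Fin n → ℝ → ℝ≥0∞ := fun i t => if i ∈ S then scaledDensity π₀ τ t else
    gaussianPDF t 1 (y i) * scaledDensity π₀ τ t with hk
  have hkm : ∀ i, Measurable (k i) := by
    intro i
    rw [hk]
    by_cases hi : i ∈ S
    · simpa [hi] using h.measurable_scaledDensity τ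
    · simpa [hi] using h.measurable_integrand τ (y i)
  have hpdf : ∀ t x : ℝ, gaussianPDF t 1 x ≤ ENNReal.ofReal (Real.exp (-(x - t) ^ 2 / 2)) := by
    intro t x
    rw [gaussianPDF_one_eq]
    apply ENNReal.ofReal_le_ofReal
    refine mul_le_of_le_one_left (Real.exp_nonneg _) (inv_le_one_of_one_le₀ ?_)
    rw [Real.one_le_sqrt]
    linarith [Real.pi_gt_three]
  calc _ ≤ ∫⁻ θ in {θ : Fin n → ℝ | 2 * E ≤ ∑ i ∈ S, (y i - θ i) ^ 2},
          ENNReal.ofReal (Real.exp (-E)) * ∏ i, k i (θ i) := by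
        refine setLIntegral_mono' hms fun θ hθ => ?_
        rw [← Finset.prod_mul_prod_compl S, ← Finset.prod_mul_prod_compl S (fun i => k i (θ i)),
          Finset.prod_mul_distrib, ← mul_assoc]
        refine mul_le_mul' (mul_le_mul' ?_ (le_of_eq ?_)) (le_of_eq ?_)
        · calc ∏ i ∈ S, gaussianPDF (θ i) 1 (y i)
              ≤ ∏ i ∈ S, ENNReal.ofReal (Real.exp (-(y i - θ i) ^ 2 / 2)) :=
                Finset.prod_le_prod' fun i _ => hpdf _ _
            _ = ENNReal.ofReal (Real.exp (∑ i ∈ S, -(y i - θ i) ^ 2 / 2)) := by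
                rw [Real.exp_sum, ENNReal.ofReal_prod_of_nonneg fun i _ => Real.exp_nonneg _]
            _ ≤ _ := by
                apply ENNReal.ofReal_le_ofReal
                apply Real.exp_le_exp.2
                have hθ' : 2 * E ≤ ∑ i ∈ S, (y i - θ i) ^ 2 := hθ
                rw [← Finset.sum_div, Finset.sum_neg_distrib]
                linarith
        · exact Finset.prod_congr rfl fun i hi => by simp [hk, hi]
        · exact Finset.prod_congr rfl fun i hi => by simp [hk, Finset.mem_compl.1 hi]
    _ ≤ ∫⁻ θ : Fin n → ℝ, ENNReal.ofReal (Real.exp (-E)) * ∏ i, k i (θ i) :=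
        setLIntegral_le_lintegral _ _
    _ = ENNReal.ofReal (Real.exp (-E)) * ∏ i, ∫⁻ t, k i t := by
        rw [lintegral_const_mul' _ _ ENNReal.ofReal_ne_top]
        congr 1
        exact lintegral_pi_prod hkm
    _ = _ := by
        rw [← Finset.prod_mul_prod_compl S]
        have e1 : ∏ i ∈ S, ∫⁻ t, k i t = 1 := Finset.prod_eq_one fun i hi => by
          simp [hk, hi, h.lintegral_scaledDensity hτ]
        rw [e1, one_mul]
        congr 1
        exact Finset.prod_congr rfl fun i hi => by
          simp [hk, Finset.mem_compl.1 hi, marginalDensity]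

theorem measurable_prod_ratio (h : IsPolynomialTailDensity π₀ α) (S : Finset (Fin n)) :
    Measurable fun q : (Fin n → ℝ) × ℝ =>
      ∏ i ∈ Sᶜ, marginalDensity π₀ q.2 (q.1 i) / gaussianPDF 0 1 (q.1 i) := by
  refine Finset.measurable_prod _ fun i _ => ?_
  have h1 : Measurable fun q : (Fin n → ℝ) × ℝ => (q.2, q.1 i) := by fun_prop
  have h2 : Measurable fun q : (Fin n → ℝ) × ℝ => q.1 i := by fun_prop
  exact (h.measurable_marginalDensity_prod.comp h1).div ((measurable_gaussianPDF 0 1).comp h2)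

theorem measurable_nullRatio (h : IsPolynomialTailDensity π₀ α) (ν : Measure ℝ) [SFinite ν]
    (S : Finset (Fin n)) (U : Set ℝ) : Measurable (nullRatio π₀ ν S U) :=
  (h.measurable_prod_ratio S).lintegral_prod_right'

theorem _root_.setLIntegral_prod_marginalDensity (π₀ : ℝ → ℝ) {n : ℕ} (ν : Measure ℝ)
    (S : Finset (Fin n)) (U : Set ℝ) (y : Fin n → ℝ) :
    ∫⁻ τ in U, ∏ i ∈ Sᶜ, marginalDensity π₀ τ (y i) ∂ν =
      nullRatio π₀ ν S U y * ∏ i ∈ Sᶜ, gaussianPDF 0 1 (y i) := by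
  rw [nullRatio, ← lintegral_mul_const' _ _
    (ENNReal.prod_ne_top fun i _ => gaussianPDF_one_ne_top _ _)]
  refine lintegral_congr fun τ => ?_
  rw [← Finset.prod_mul_distrib]
  refine Finset.prod_congr rfl fun i _ => ?_
  rw [ENNReal.div_mul_cancel (gaussianPDF_one_pos _ _).ne' (gaussianPDF_one_ne_top _ _)]

theorem lintegral_marginalDensity (h : IsPolynomialTailDensity π₀ α) {τ : ℝ} (hτ : 0 < τ) :
    ∫⁻ y, marginalDensity π₀ τ y = 1 := by
  unfold marginalDensity
  rw [lintegral_lintegral_swap]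
  · have e : ∀ t, ∫⁻ y, gaussianPDF t 1 y * scaledDensity π₀ τ t = scaledDensity π₀ τ t := by
      intro t
      rw [lintegral_mul_const _ (measurable_gaussianPDF t 1),
        lintegral_gaussianPDF_eq_one t one_ne_zero, one_mul]
    simp_rw [e]
    exact h.lintegral_scaledDensity hτ
  · have h1 : Measurable fun q : ℝ × ℝ => (q.2, q.1) := by fun_prop
    have h2 : Measurable fun q : ℝ × ℝ => gaussianPDF q.2 1 q.1 * scaledDensity π₀ τ q.2 :=
      (measurable_gaussianPDF_one_prod.comp h1).mul
        ((h.measurable_scaledDensity τ).comp measurable_snd)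
    exact h2.aemeasurable

theorem lintegral_ratio (h : IsPolynomialTailDensity π₀ α) {τ : ℝ} (hτ : 0 < τ) :
    ∫⁻ y, marginalDensity π₀ τ y / gaussianPDF 0 1 y ∂(gaussianReal 0 1) = 1 := by
  have hm : Measurable fun y => marginalDensity π₀ τ y / gaussianPDF 0 1 y :=
    (h.measurable_marginalDensity τ).div (measurable_gaussianPDF 0 1)
  rw [lintegral_gaussianReal_one 0 hm, ← h.lintegral_marginalDensity hτ]
  refine lintegral_congr fun y => ?_
  exact ENNReal.mul_div_cancel (gaussianPDF_one_pos _ _).ne' (gaussianPDF_one_ne_top _ _)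

/-- Null observations are pure noise under the truth, so each likelihood ratio has expectation 1,
whatever `τ`. After Tonelli only the mass of `U` remains. -/
theorem lintegral_nullRatio_le (h : IsPolynomialTailDensity π₀ α) (ν : Measure ℝ) [SFinite ν]
    (hν : ν (Iic 0) = 0) (S : Finset (Fin n)) (U : Set ℝ) (θs : Fin n → ℝ)
    (hθ : ∀ i ∉ S, θs i = 0) :
    ∫⁻ y, nullRatio π₀ ν S U y ∂(dataLaw θs) ≤ ν U := by
  unfold nullRatio dataLaw
  rw [lintegral_lintegral_swap (h.measurable_prod_ratio S).aemeasurable]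
  have hpos : ∀ᵐ τ ∂(ν.restrict U), 0 < τ := by
    refine ae_restrict_of_ae ?_
    rw [ae_iff]
    simpa [Iic] using hν
  have e : ∀ᵐ τ ∂(ν.restrict U), ∫⁻ y : Fin n → ℝ,
      ∏ i ∈ Sᶜ, marginalDensity π₀ τ (y i) / gaussianPDF 0 1 (y i)
        ∂(Measure.pi fun i => gaussianReal (θs i) 1) = 1 := by
    filter_upwards [hpos] with τ hτ
    set k : Fin n → ℝ → ℝ≥0∞ := fun i x => if i ∈ S then 1 else
      marginalDensity π₀ τ x / gaussianPDF 0 1 x with hk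
    have hm : Measurable fun y => marginalDensity π₀ τ y / gaussianPDF 0 1 y :=
      (h.measurable_marginalDensity τ).div (measurable_gaussianPDF 0 1)
    have hkm : ∀ i, Measurable (k i) := by
      intro i
      by_cases hi : i ∈ S
      · simp [hk, hi]
      · simpa [hk, hi] using hm
    have e1 : ∀ y : Fin n → ℝ, ∏ i ∈ Sᶜ, marginalDensity π₀ τ (y i) / gaussianPDF 0 1 (y i) =
        ∏ i, k i (y i) := by
      intro y
      rw [← Finset.prod_mul_prod_compl S (fun i => k i (y i)),
        Finset.prod_eq_one (s := S) fun i hi => by simp [hk, hi], one_mul]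
      exact Finset.prod_congr rfl fun i hi => by simp [hk, Finset.mem_compl.1 hi]
    simp_rw [e1]
    rw [lintegral_pi_prod hkm]
    refine Finset.prod_eq_one fun i _ => ?_
    by_cases hi : i ∈ S
    · simp [hk, hi]
    · simp only [hk, hi, if_false, hθ i hi]
      exact h.lintegral_ratio hτ
  rw [lintegral_congr_ae e]
  simp

/-- Scales are split at `T`. Above `T` nothing is asked of `θ` and the signal marginals are bounded
by 1; below `T` either the null or the signal coordinates are far. The null term is relative to the
full marginal and cancels with the denominator exactly. The other two are relative to the noise
density of the null data, and `hD` converts them at the price `1/d`. -/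
theorem posteriorProb_le (h : IsPolynomialTailDensity π₀ α) (ν : Measure ℝ) [SFinite ν]
    (hν : ν (Iic 0) = 0) (y : Fin n → ℝ) (S : Finset (Fin n)) {T E κ d : ℝ} (hκ : 0 < κ)
    (hd : 0 < d) (g : Fin n → ℝ≥0∞) {A : Set (Fin n → ℝ)}
    (hA : ∀ θ ∈ A, κ ≤ ∑ i ∈ Sᶜ, (|θ i| + θ i ^ 2) ∨ 2 * E ≤ ∑ i ∈ S, (y i - θ i) ^ 2)
    (hg : ∀ τ, 0 < τ → τ < T → ∀ i ∈ Sᶜ, ∫⁻ t, ENNReal.ofReal (|t| + t ^ 2) *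
      (gaussianPDF t 1 (y i) * scaledDensity π₀ τ t) ≤ g i * marginalDensity π₀ τ (y i))
    (hD : ENNReal.ofReal d * ∏ i ∈ Sᶜ, gaussianPDF 0 1 (y i) ≤
      ∫⁻ τ, ∏ i, marginalDensity π₀ τ (y i) ∂ν) :
    posteriorProb π₀ ν y A ≤ (ENNReal.ofReal κ)⁻¹ * (∑ i ∈ Sᶜ, g i) +
      (ENNReal.ofReal d)⁻¹ * (nullRatio π₀ ν S (Ici T) y +
        ENNReal.ofReal (Real.exp (-E)) * nullRatio π₀ ν S univ y) := by
  set D := ∫⁻ τ, ∏ i, marginalDensity π₀ τ (y i) ∂ν with hDdef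
  set Φ := ∏ i ∈ Sᶜ, gaussianPDF 0 1 (y i) with hΦ
  set H := (ENNReal.ofReal κ)⁻¹ * (∑ i ∈ Sᶜ, g i) with hH
  have hd' : ENNReal.ofReal d ≠ 0 := by simpa using hd
  have hpos : ∀ᵐ τ ∂ν, 0 < τ := by
    rw [ae_iff]
    simpa [Iic] using hν
  have hAsub : A ⊆ {θ : Fin n → ℝ | κ ≤ ∑ i ∈ Sᶜ, (|θ i| + θ i ^ 2)} ∪
      {θ : Fin n → ℝ | 2 * E ≤ ∑ i ∈ S, (y i - θ i) ^ 2} := fun θ hθ => hA θ hθ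
  have hmarg : ∀ N : Finset (Fin n), Measurable fun τ => ∏ i ∈ N, marginalDensity π₀ τ (y i) := by
    exact fun N => Finset.measurable_prod _ fun i _ => h.measurable_marginalDensity_left (y i)
  have hlarge : ∫⁻ τ in Ici T, (∫⁻ θ in A,
      ∏ i, gaussianPDF (θ i) 1 (y i) * scaledDensity π₀ τ (θ i)) ∂ν ≤
      nullRatio π₀ ν S (Ici T) y * Φ := by
    rw [← setLIntegral_prod_marginalDensity]
    refine lintegral_mono_ae ?_
    filter_upwards [ae_restrict_of_ae hpos] with τ hτ
    refine (setLIntegral_le_lintegral _ _).trans ?_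
    rw [h.lintegral_prod_integrand]
    exact h.prod_marginalDensity_le hτ y S
  have hsmall : ∫⁻ τ in (Ici T)ᶜ, (∫⁻ θ in A,
      ∏ i, gaussianPDF (θ i) 1 (y i) * scaledDensity π₀ τ (θ i)) ∂ν ≤
      H * D + ENNReal.ofReal (Real.exp (-E)) * (nullRatio π₀ ν S univ y * Φ) := by
    calc _ ≤ ∫⁻ τ in (Ici T)ᶜ, (H * ∏ i, marginalDensity π₀ τ (y i) +
            ENNReal.ofReal (Real.exp (-E)) * ∏ i ∈ Sᶜ, marginalDensity π₀ τ (y i)) ∂ν := by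
          refine lintegral_mono_ae ?_
          filter_upwards [ae_restrict_of_ae hpos, ae_restrict_mem measurableSet_Ici.compl]
            with τ hτ hτT
          refine (lintegral_mono_set hAsub).trans ((lintegral_union_le _ _ _).trans ?_)
          refine add_le_add ?_ (h.setLIntegral_signal_le hτ y S E)
          exact h.setLIntegral_null_le τ y Sᶜ hκ g (hg τ hτ (by simpa using hτT))
      _ ≤ ∫⁻ τ, (H * ∏ i, marginalDensity π₀ τ (y i) +
            ENNReal.ofReal (Real.exp (-E)) * ∏ i ∈ Sᶜ, marginalDensity π₀ τ (y i)) ∂ν :=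
          setLIntegral_le_lintegral _ _
      _ = _ := by
          rw [lintegral_add_left ((hmarg _).const_mul _), lintegral_const_mul _ (hmarg _),
            lintegral_const_mul _ (hmarg _), ← setLIntegral_prod_marginalDensity,
            Measure.restrict_univ]
  have hΦD : Φ ≤ (ENNReal.ofReal d)⁻¹ * D := by
    rw [← ENNReal.div_eq_inv_mul, ENNReal.le_div_iff_mul_le (Or.inl hd')
      (Or.inl ENNReal.ofReal_ne_top), mul_comm]
    exact hD
  unfold posteriorProb
  refine ENNReal.div_le_of_le_mul ?_
  rw [h.lintegral_likelihood_mul_priorDensity, h.setLIntegral_likelihood_mul_priorDensity,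
    ← lintegral_add_compl _ (measurableSet_Ici (a := T))]
  refine (add_le_add hlarge hsmall).trans ?_
  rw [← hDdef]
  calc nullRatio π₀ ν S (Ici T) y * Φ +
        (H * D + ENNReal.ofReal (Real.exp (-E)) * (nullRatio π₀ ν S univ y * Φ))
      = H * D + (nullRatio π₀ ν S (Ici T) y +
          ENNReal.ofReal (Real.exp (-E)) * nullRatio π₀ ν S univ y) * Φ := by ring
    _ ≤ H * D + (nullRatio π₀ ν S (Ici T) y +
          ENNReal.ofReal (Real.exp (-E)) * nullRatio π₀ ν S univ y) *
          ((ENNReal.ofReal d)⁻¹ * D) := by gcongr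
    _ = _ := by ring

theorem expectedPosteriorProb_le (h : IsPolynomialTailDensity π₀ α) (ν : Measure ℝ)
    [IsProbabilityMeasure ν] (hν : ν (Iic 0) = 0) (S : Finset (Fin n)) (θs : Fin n → ℝ)
    (hθ : ∀ i ∉ S, θs i = 0) {T E κ d : ℝ} (hκ : 0 < κ) (hd : 0 < d) {g : ℝ → ℝ≥0∞}
    (hgm : Measurable g) {A Y : Set (Fin n → ℝ)} (hY : MeasurableSet Y)
    (hA : ∀ y ∈ Y, ∀ θ ∈ A,
      κ ≤ ∑ i ∈ Sᶜ, (|θ i| + θ i ^ 2) ∨ 2 * E ≤ ∑ i ∈ S, (y i - θ i) ^ 2)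
    (hg : ∀ τ x, 0 < τ → τ < T → ∫⁻ t, ENNReal.ofReal (|t| + t ^ 2) *
      (gaussianPDF t 1 x * scaledDensity π₀ τ t) ≤ g x * marginalDensity π₀ τ x)
    (hD : ∀ y ∈ Y, ENNReal.ofReal d * ∏ i ∈ Sᶜ, gaussianPDF 0 1 (y i) ≤
      ∫⁻ τ, ∏ i, marginalDensity π₀ τ (y i) ∂ν) :
    expectedPosteriorProb π₀ ν θs A ≤ dataLaw θs Yᶜ +
      ((ENNReal.ofReal κ)⁻¹ * (n * ∫⁻ x, g x ∂(gaussianReal 0 1)) +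
      (ENNReal.ofReal d)⁻¹ * (ν (Ici T) + ENNReal.ofReal (Real.exp (-E)))) := by
  have : IsProbabilityMeasure (dataLaw θs) := by unfold dataLaw; infer_instance
  have hR := h.measurable_nullRatio ν S (Ici T)
  have hR' := h.measurable_nullRatio ν S univ
  have hgs : Measurable fun y : Fin n → ℝ => ∑ i ∈ Sᶜ, g (y i) :=
    Finset.measurable_sum _ fun i _ => hgm.comp (measurable_pi_apply i)
  have hsum : ∫⁻ y, ∑ i ∈ Sᶜ, g (y i) ∂(dataLaw θs) ≤ n * ∫⁻ x, g x ∂(gaussianReal 0 1) := by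
    have hgi : ∀ i : Fin n, Measurable fun y : Fin n → ℝ => g (y i) := fun i =>
      hgm.comp (measurable_pi_apply i)
    rw [lintegral_finsetSum _ fun i _ => hgi i]
    calc ∑ i ∈ Sᶜ, ∫⁻ y, g (y i) ∂(dataLaw θs)
        = ∑ i ∈ Sᶜ, ∫⁻ x, g x ∂(gaussianReal 0 1) := by
          refine Finset.sum_congr rfl fun i hi => ?_
          unfold dataLaw
          rw [lintegral_pi_eval hgm i, hθ i (Finset.mem_compl.1 hi)]
      _ ≤ ∑ i : Fin n, ∫⁻ x, g x ∂(gaussianReal 0 1) :=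
          Finset.sum_le_sum_of_subset (Finset.subset_univ _)
      _ = _ := by simp
  have hd' : ENNReal.ofReal d ≠ 0 := by simpa using hd
  unfold expectedPosteriorProb
  calc ∫⁻ y, posteriorProb π₀ ν y A ∂(dataLaw θs)
      ≤ ∫⁻ y, (Yᶜ.indicator 1 y + ((ENNReal.ofReal κ)⁻¹ * (∑ i ∈ Sᶜ, g (y i)) +
        (ENNReal.ofReal d)⁻¹ * (nullRatio π₀ ν S (Ici T) y +
          ENNReal.ofReal (Real.exp (-E)) * nullRatio π₀ ν S univ y))) ∂(dataLaw θs) := by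
        refine lintegral_mono fun y => ?_
        by_cases hy : y ∈ Y
        · refine le_trans ?_ le_add_self
          exact h.posteriorProb_le ν hν y S hκ hd (fun i => g (y i)) (hA y hy)
            (fun τ hτ hτT i _ => hg τ (y i) hτ hτT) (hD y hy)
        · refine le_trans ?_ le_self_add
          rw [indicator_of_mem (by simpa using hy)]
          exact posteriorProb_le_one _ _ _ _
    _ = dataLaw θs Yᶜ + ((ENNReal.ofReal κ)⁻¹ * (∫⁻ y, ∑ i ∈ Sᶜ, g (y i) ∂(dataLaw θs)) +
        (ENNReal.ofReal d)⁻¹ * (∫⁻ y, nullRatio π₀ ν S (Ici T) y ∂(dataLaw θs) +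
          ENNReal.ofReal (Real.exp (-E)) * ∫⁻ y, nullRatio π₀ ν S univ y ∂(dataLaw θs))) := by
        rw [lintegral_add_left (measurable_one.indicator hY.compl),
          lintegral_indicator_one hY.compl, lintegral_add_left (hgs.const_mul _),
          lintegral_const_mul _ hgs, lintegral_const_mul' _ _ (ENNReal.inv_ne_top.2 hd'),
          lintegral_add_left hR, lintegral_const_mul _ hR']
    _ ≤ _ := by
        gcongr
        · exact h.lintegral_nullRatio_le ν hν S _ θs hθ
        · refine mul_le_of_le_one_right zero_le ?_
          exact (h.lintegral_nullRatio_le ν hν S _ θs hθ).trans prob_le_one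

end IsPolynomialTailDensity

/-! ### Lower bounds for the marginals and the denominator -/

theorem eventually_rpow_lt {C p ε : ℝ} (hp : 0 < p) (hε : 0 < ε) :
    ∀ᶠ r in 𝓝[>] (0 : ℝ), C * r ^ p < ε := by
  have h1 : ContinuousAt (fun r : ℝ => C * r ^ p) 0 :=
    continuousAt_const.mul (Real.continuousAt_rpow_const _ _ (Or.inr hp.le))
  have h2 : Tendsto (fun r : ℝ => C * r ^ p) (𝓝 0) (𝓝 0) := by
    simpa [Real.zero_rpow hp.ne'] using h1.tendsto
  exact (h2.mono_left nhdsWithin_le_nhds).eventually_lt_const hε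

theorem exp_neg_two_mul_le {x : ℝ} (hx0 : 0 ≤ x) (hx : x ≤ 1 / 2) :
    Real.exp (-(2 * x)) ≤ 1 - x := by
  have h1 : 1 + 2 * x ≤ Real.exp (2 * x) := by linarith [Real.add_one_le_exp (2 * x)]
  rw [Real.exp_neg]
  calc (Real.exp (2 * x))⁻¹ ≤ (1 + 2 * x)⁻¹ := inv_anti₀ (by linarith) h1
    _ ≤ 1 - x := by
      rw [inv_le_iff_one_le_mul₀ (by linarith)]
      nlinarith

namespace IsPolynomialTailDensity

variable {π₀ : ℝ → ℝ} {α : ℝ}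

/-- Only `|t| ≤ r` is kept. The scale bound makes the prior mass outside `O(r)`, so each null
coordinate loses a factor `exp (-O((1 + |y|) r))`, and `n` of them lose `exp (-O(s))` when the data
are of typical size. -/
theorem exists_null_le_marginalDensity (h : IsPolynomialTailDensity π₀ α) (hα : 1 < α) :
    ∃ C r₀ : ℝ, 0 < C ∧ 0 < r₀ ∧ ∀ r τ y : ℝ, 0 < r → r ≤ r₀ → 0 < τ → τ ≤ r ^ (α / (α - 1)) →
      ENNReal.ofReal (Real.exp (-((|y| + C) * r))) * gaussianPDF 0 1 y ≤
        marginalDensity π₀ τ y := by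
  obtain ⟨M, C, hM, hC, hb⟩ := h.exists_one_le_lintegral_abs_le hα
  have hα1 : 0 < α - 1 := by linarith
  have hα2 : 0 < 1 / (α - 1) := by positivity
  obtain ⟨t₁, ht₁, hr₁⟩ := mem_nhdsGT_iff_exists_Ioc_subset.1
    (eventually_rpow_lt (C := M) hα2 one_pos)
  refine ⟨1 + 2 * C, min t₁ (min 1 (1 / (2 * C))), by positivity,
    lt_min ht₁ (lt_min one_pos (by positivity)), fun r τ y hr hr₀ hτ hτr => ?_⟩
  have hr1 : r ≤ 1 := hr₀.trans ((min_le_right _ _).trans (min_le_left _ _))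
  have hrC : C * r ≤ 1 / 2 := by
    have := hr₀.trans ((min_le_right _ _).trans (min_le_right _ _))
    rw [le_div_iff₀ (by positivity)] at this
    linarith
  -- The exponent is one power of `r` for the window width plus `1/(α-1)`, which makes `(τ/r)^(α-1)
  -- ≤ r`.
  have hsplit : r ^ (α / (α - 1)) = r * r ^ (1 / (α - 1)) := by
    rw [show α / (α - 1) = 1 + 1 / (α - 1) by field_simp; ring, Real.rpow_add hr, Real.rpow_one]
  rw [hsplit] at hτr
  have hMτ : M * τ ≤ r := by
    have h1 : M * r ^ (1 / (α - 1)) < 1 := hr₁ ⟨hr, hr₀.trans (min_le_left _ _)⟩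
    calc M * τ ≤ M * (r * r ^ (1 / (α - 1))) := by gcongr
      _ = r * (M * r ^ (1 / (α - 1))) := by ring
      _ ≤ r * 1 := by gcongr
      _ = r := mul_one r
  have hpow : (τ / r) ^ (α - 1) ≤ r := by
    calc (τ / r) ^ (α - 1) ≤ (r ^ (1 / (α - 1))) ^ (α - 1) := by
          have : τ / r ≤ r ^ (1 / (α - 1)) := by rw [div_le_iff₀ hr]; linarith
          gcongr
      _ = r := by rw [← Real.rpow_mul hr.le, one_div_mul_cancel hα1.ne', Real.rpow_one]
  have hmass := hb τ r hτ hr hMτ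
  have hI : ENNReal.ofReal (Real.exp (-(2 * (C * r)))) ≤
      ∫⁻ x in {x : ℝ | |x| ≤ r}, scaledDensity π₀ τ x := by
    refine (ENNReal.ofReal_le_ofReal (exp_neg_two_mul_le (by positivity) hrC)).trans ?_
    rw [ENNReal.ofReal_sub _ (by positivity), ENNReal.ofReal_one]
    refine tsub_le_iff_right.2 (hmass.trans ?_)
    gcongr
  refine le_trans ?_ (h.le_marginalDensity_of_abs_le τ y r)
  calc ENNReal.ofReal (Real.exp (-((|y| + (1 + 2 * C)) * r))) * gaussianPDF 0 1 y
      ≤ ENNReal.ofReal (Real.exp (-(|y| * r + r ^ 2 / 2)) * Real.exp (-(2 * (C * r)))) *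
          gaussianPDF 0 1 y := by
        refine mul_le_mul' (ENNReal.ofReal_le_ofReal ?_) le_rfl
        rw [← Real.exp_add]
        apply Real.exp_le_exp.2
        nlinarith
    _ = gaussianPDF 0 1 y * ENNReal.ofReal (Real.exp (-(|y| * r + r ^ 2 / 2))) *
          ENNReal.ofReal (Real.exp (-(2 * (C * r)))) := by
        rw [ENNReal.ofReal_mul (Real.exp_nonneg _)]
        ring
    _ ≤ _ := mul_le_mul' le_rfl hI

theorem exists_tail_le_marginalDensity (h : IsPolynomialTailDensity π₀ α) (hα : 1 < α) :
    ∃ c t₀ : ℝ, 0 < c ∧ 0 < t₀ ∧ ∀ τ y : ℝ, 0 < τ → τ ≤ t₀ →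
      ENNReal.ofReal (c * τ ^ (α - 1) * (|y| + 2) ^ (-α)) ≤ marginalDensity π₀ τ y := by
  obtain ⟨M, C₁, C₂, hM, hC₁, hC₂, hb⟩ := h.exists_scaledDensity_bounds
  refine ⟨(√(2 * Real.pi))⁻¹ * Real.exp (-2) * C₁, 1 / (2 * M), by positivity, by positivity,
    fun τ y hτ hτ₀ => ?_⟩
  have hMτ : M * τ < 1 := by
    rw [le_div_iff₀ (by positivity)] at hτ₀
    linarith
  -- A unit interval near `y`, displaced away from 0: it lies in the range of the tail bound even
  -- when `y` is near 0, and the Gaussian factor stays above a constant.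
  obtain ⟨a, ha⟩ : ∃ a : ℝ, ∀ t ∈ Icc a (a + 1), 1 ≤ |t| ∧ |t| ≤ |y| + 2 ∧ (y - t) ^ 2 ≤ 4 := by
    rcases le_total 0 y with hy | hy
    · refine ⟨y + 1, fun t ht => ?_⟩
      rw [abs_of_nonneg hy, abs_of_nonneg (by linarith [ht.1])]
      refine ⟨by linarith [ht.1], by linarith [ht.2], ?_⟩
      nlinarith [ht.1, ht.2]
    · refine ⟨y - 2, fun t ht => ?_⟩
      rw [abs_of_nonpos hy, abs_of_nonpos (by linarith [ht.2])]
      refine ⟨by linarith [ht.2], by linarith [ht.1], ?_⟩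
      nlinarith [ht.1, ht.2]
  unfold marginalDensity
  calc ENNReal.ofReal ((√(2 * Real.pi))⁻¹ * Real.exp (-2) * C₁ * τ ^ (α - 1) * (|y| + 2) ^ (-α))
      = ∫⁻ t in Icc a (a + 1), ENNReal.ofReal
          ((√(2 * Real.pi))⁻¹ * Real.exp (-2) * C₁ * τ ^ (α - 1) * (|y| + 2) ^ (-α)) := by
        simp
    _ ≤ ∫⁻ t in Icc a (a + 1), gaussianPDF t 1 y * scaledDensity π₀ τ t := by
        refine setLIntegral_mono' measurableSet_Icc fun t ht => ?_
        obtain ⟨h1, h2, h3⟩ := ha t ht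
        refine le_trans ?_ (mul_le_mul' le_rfl (hb τ t hτ (hMτ.trans_le h1)).1)
        rw [gaussianPDF_one_eq, ← ENNReal.ofReal_mul (by positivity)]
        apply ENNReal.ofReal_le_ofReal
        have e1 : Real.exp (-2) ≤ Real.exp (-(y - t) ^ 2 / 2) := by
          apply Real.exp_le_exp.2
          linarith
        have e2 : (|y| + 2) ^ (-α) ≤ |t| ^ (-α) :=
          Real.rpow_le_rpow_of_nonpos (by linarith) h2 (by linarith)
        calc _ = ((√(2 * Real.pi))⁻¹ * Real.exp (-2)) *
              (C₁ * τ ^ (α - 1) * (|y| + 2) ^ (-α)) := by ring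
          _ ≤ _ := by gcongr
    _ ≤ _ := setLIntegral_le_lintegral _ _

/-- The factor `τ^(α-1)` costs at most `(1 + ω/2) log (1/r)`, and `(|y| + 2)^(-α)` costs `(ω/5) log
(1/r)` through the size of `θ`, hence `1 + 7ω/10`. The noise enters only linearly, through `|y -
θ|`. -/
theorem exists_signal_le_marginalDensity (h : IsPolynomialTailDensity π₀ α) (hα : 1 < α) {ω : ℝ}
    (hω : 0 < ω) :
    ∃ C r₀ : ℝ, 0 < r₀ ∧ ∀ r τ θ y : ℝ, 0 < r → r ≤ r₀ →
      r ^ ((1 + ω / 2) / (α - 1)) ≤ τ → τ ≤ r ^ (α / (α - 1)) → |θ| ≤ r⁻¹ ^ (ω / (5 * α)) →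
      ENNReal.ofReal (Real.exp (-((1 + 7 * ω / 10) * -Real.log r + C + α * |y - θ|))) ≤
        marginalDensity π₀ τ y := by
  obtain ⟨c, t₀, hc, ht₀, hb⟩ := h.exists_tail_le_marginalDensity hα
  have hα1 : 0 < α - 1 := by linarith
  have hα0 : 0 < α := by linarith
  obtain ⟨t₁, ht₁, hr₁⟩ := mem_nhdsGT_iff_exists_Ioc_subset.1
    (eventually_rpow_lt (C := 1) (p := α / (α - 1)) (by positivity) ht₀)
  refine ⟨α * Real.log 3 - Real.log c, min t₁ 1, lt_min ht₁ one_pos,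
    fun r τ θ y hr hr₀ hτ hτ' hθ => ?_⟩
  have hr1 : r ≤ 1 := hr₀.trans (min_le_right _ _)
  have hτ0 : 0 < τ := lt_of_lt_of_le (by positivity) hτ
  have hτt : τ ≤ t₀ := by
    have : 1 * r ^ (α / (α - 1)) < t₀ := hr₁ ⟨hr, hr₀.trans (min_le_left _ _)⟩
    linarith
  refine le_trans (ENNReal.ofReal_le_ofReal ?_) (hb τ y hτ0 hτt)
  set R := r⁻¹ ^ (ω / (5 * α)) with hR
  have hR1 : 1 ≤ R := Real.one_le_rpow ((one_le_inv₀ hr).2 hr1) (by positivity)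
  have hlogR : Real.log R = -Real.log r * (ω / (5 * α)) := by
    rw [hR, Real.log_rpow (by positivity), Real.log_inv]
    ring
  have hy : |y| + 2 ≤ R * (3 * Real.exp |y - θ|) := by
    have h1 : |y| ≤ |y - θ| + |θ| := by
      have := abs_add_le (y - θ) θ
      rwa [sub_add_cancel] at this
    have h2 : |y - θ| + 1 ≤ Real.exp |y - θ| := Real.add_one_le_exp _
    nlinarith [abs_nonneg (y - θ)]
  have hlogτ : (1 + ω / 2) * Real.log r ≤ (α - 1) * Real.log τ := by
    have h1 := Real.log_le_log (by positivity) hτ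
    rw [Real.log_rpow hr, div_mul_eq_mul_div, div_le_iff₀ hα1] at h1
    linarith
  have hpos : 0 < c * τ ^ (α - 1) * (|y| + 2) ^ (-α) := by positivity
  rw [← Real.le_log_iff_exp_le hpos, Real.log_mul (by positivity) (by positivity),
    Real.log_mul (by positivity) (by positivity), Real.log_rpow hτ0, Real.log_rpow (by positivity)]
  have hlogy : Real.log (|y| + 2) ≤ Real.log R + (Real.log 3 + |y - θ|) := by
    rw [← Real.log_exp |y - θ|, ← Real.log_mul (by norm_num) (by positivity),
      ← Real.log_mul (by positivity) (by positivity)]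
    exact Real.log_le_log (by positivity) hy
  have h4 : α * Real.log (|y| + 2) ≤ α * (Real.log R + (Real.log 3 + |y - θ|)) := by gcongr
  have h5 : α * Real.log R = -Real.log r * (ω / 5) := by
    rw [hlogR]
    field_simp
  linarith

/-- The coordinatewise bounds hold uniformly over the interval of scales, so its mass factors out.
The relation `n r = |S|` puts the cost of all null coordinates on the scale of `|S|`. -/
theorem exists_le_lintegral_prod_marginalDensity (h : IsPolynomialTailDensity π₀ α) (hα : 1 < α)
    {ω : ℝ} (hω : 0 < ω) :
    ∃ C r₀ : ℝ, 0 < r₀ ∧ ∀ (n : ℕ) (S : Finset (Fin n)) (θs y : Fin n → ℝ) (ν : Measure ℝ)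
      (r ℓ : ℝ), 0 < r → r ≤ r₀ → n * r = S.card → (∀ i, |θs i| ≤ r⁻¹ ^ (ω / (5 * α))) →
      ∑ i ∈ S, (y i - θs i) ^ 2 ≤ S.card * ℓ → ∑ i ∈ Sᶜ, |y i| ≤ n * ℓ →
      ENNReal.ofReal (Real.exp (-(S.card * ((1 + 7 * ω / 10) * -Real.log r + C +
        (1 + α) * ℓ)))) * ν (Icc (r ^ ((1 + ω / 2) / (α - 1))) (r ^ (α / (α - 1)))) *
        ∏ i ∈ Sᶜ, gaussianPDF 0 1 (y i) ≤ ∫⁻ τ, ∏ i, marginalDensity π₀ τ (y i) ∂ν := by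
  obtain ⟨C₁, r₁, hC₁, hr₁, hnull⟩ := h.exists_null_le_marginalDensity hα
  obtain ⟨C₂, r₂, hr₂, hsig⟩ := h.exists_signal_le_marginalDensity hα hω
  refine ⟨C₁ + C₂ + α, min r₁ r₂, lt_min hr₁ hr₂,
    fun n S θs y ν r ℓ hr hr₀ hnr hθ hS hN => ?_⟩
  set U := Icc (r ^ ((1 + ω / 2) / (α - 1))) (r ^ (α / (α - 1))) with hU
  set Φ := ∏ i ∈ Sᶜ, gaussianPDF 0 1 (y i) with hΦ
  set L := -Real.log r with hL
  have hα0 : 0 < α := by linarith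
  have hbound : ∀ τ ∈ U, ENNReal.ofReal (Real.exp (-(S.card * ((1 + 7 * ω / 10) * L +
      (C₁ + C₂ + α) + (1 + α) * ℓ)))) * Φ ≤ ∏ i, marginalDensity π₀ τ (y i) := by
    intro τ hτ
    have hτ0 : 0 < τ := lt_of_lt_of_le (by positivity) hτ.1
    rw [← Finset.prod_mul_prod_compl S]
    have h1 : ENNReal.ofReal (Real.exp (-∑ i ∈ S, ((1 + 7 * ω / 10) * L + C₂ +
        α * |y i - θs i|))) ≤ ∏ i ∈ S, marginalDensity π₀ τ (y i) := by
      rw [← Finset.sum_neg_distrib, Real.exp_sum,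
        ENNReal.ofReal_prod_of_nonneg fun i _ => Real.exp_nonneg _]
      exact Finset.prod_le_prod' fun i _ =>
        hsig r τ (θs i) (y i) hr (hr₀.trans (min_le_right _ _)) hτ.1 hτ.2 (hθ i)
    have h2 : ENNReal.ofReal (Real.exp (-∑ i ∈ Sᶜ, (|y i| + C₁) * r)) * Φ ≤
        ∏ i ∈ Sᶜ, marginalDensity π₀ τ (y i) := by
      rw [← Finset.sum_neg_distrib, Real.exp_sum,
        ENNReal.ofReal_prod_of_nonneg fun i _ => Real.exp_nonneg _, hΦ, ← Finset.prod_mul_distrib]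
      exact Finset.prod_le_prod' fun i _ =>
        hnull r τ (y i) hr (hr₀.trans (min_le_left _ _)) hτ0 hτ.2
    refine le_trans ?_ (mul_le_mul' h1 h2)
    rw [← mul_assoc, ← ENNReal.ofReal_mul (Real.exp_nonneg _), ← Real.exp_add]
    refine mul_le_mul' (ENNReal.ofReal_le_ofReal (Real.exp_le_exp.2 ?_)) le_rfl
    have h3 : ∑ i ∈ S, |y i - θs i| ≤ S.card + S.card * ℓ := by
      calc ∑ i ∈ S, |y i - θs i| ≤ ∑ i ∈ S, (1 + (y i - θs i) ^ 2) := by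
            refine Finset.sum_le_sum fun i _ => ?_
            rw [← sq_abs (y i - θs i)]
            nlinarith [sq_nonneg (|y i - θs i| - 1), abs_nonneg (y i - θs i)]
        _ = S.card + ∑ i ∈ S, (y i - θs i) ^ 2 := by rw [Finset.sum_add_distrib]; simp
        _ ≤ _ := by gcongr
    have h4 : ∑ i ∈ Sᶜ, (|y i| + C₁) * r ≤ S.card * ℓ + S.card * C₁ := by
      rw [← Finset.sum_mul, Finset.sum_add_distrib, Finset.sum_const, nsmul_eq_mul, add_mul]
      have h5 : (Sᶜ.card : ℝ) ≤ n := by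
        have := Finset.card_le_univ Sᶜ
        rw [Fintype.card_fin] at this
        exact_mod_cast this
      have h6 : (∑ i ∈ Sᶜ, |y i|) * r ≤ n * ℓ * r := by gcongr
      have h7 : (Sᶜ.card : ℝ) * C₁ * r ≤ n * C₁ * r := by gcongr
      have h8 : (n : ℝ) * ℓ * r = S.card * ℓ := by rw [← hnr]; ring
      have h9 : (n : ℝ) * C₁ * r = S.card * C₁ := by rw [← hnr]; ring
      linarith
    have h10 : ∑ i ∈ S, ((1 + 7 * ω / 10) * L + C₂ + α * |y i - θs i|) =
        S.card * ((1 + 7 * ω / 10) * L + C₂) + α * ∑ i ∈ S, |y i - θs i| := by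
      rw [Finset.sum_add_distrib, Finset.sum_const, nsmul_eq_mul, ← Finset.mul_sum]
    rw [h10]
    have h11 : α * ∑ i ∈ S, |y i - θs i| ≤ α * (S.card + S.card * ℓ) := by gcongr
    linarith
  calc _ = ∫⁻ _ in U, ENNReal.ofReal (Real.exp (-(S.card * ((1 + 7 * ω / 10) * L +
          (C₁ + C₂ + α) + (1 + α) * ℓ)))) * Φ ∂ν := by
        rw [setLIntegral_const]
        ring
    _ ≤ ∫⁻ τ in U, ∏ i, marginalDensity π₀ τ (y i) ∂ν :=
        setLIntegral_mono' measurableSet_Icc hbound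
    _ ≤ _ := setLIntegral_le_lintegral _ _

end IsPolynomialTailDensity

/-! ### Typical data and noise in the signal coordinates -/

theorem exists_lintegral_exp_mul_sq_le {A b : ℝ} (hA : 0 < A) (hb : b < 1 / 2) :
    ∃ B : ℝ, 0 < B ∧ ∀ r : ℝ, 0 < r →
      ∫⁻ x, ENNReal.ofReal (r * (A * Real.exp (b * x ^ 2))) ∂(gaussianReal 0 1) ≤
        ENNReal.ofReal (r * B) := by
  have hb' : 0 < 1 / 2 - b := by linarith
  set J := ∫ x : ℝ, Real.exp (-(1 / 2 - b) * x ^ 2) with hJ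
  have hJ0 : 0 < J := by
    rw [hJ, integral_gaussian]
    have := Real.pi_pos
    positivity
  refine ⟨A * ((√(2 * Real.pi))⁻¹ * J), by positivity, fun r hr => ?_⟩
  rw [lintegral_gaussianReal_one 0 (by fun_prop)]
  apply le_of_eq
  calc ∫⁻ x, gaussianPDF 0 1 x * ENNReal.ofReal (r * (A * Real.exp (b * x ^ 2)))
      = ∫⁻ x, ENNReal.ofReal (r * (A * (√(2 * Real.pi))⁻¹)) *
          ENNReal.ofReal (Real.exp (-(1 / 2 - b) * x ^ 2)) := by
        refine lintegral_congr fun x => ?_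
        rw [gaussianPDF_one_eq, ← ENNReal.ofReal_mul (by positivity),
          ← ENNReal.ofReal_mul (by positivity),
          show -(1 / 2 - b) * x ^ 2 = -(x - 0) ^ 2 / 2 + b * x ^ 2 by ring, Real.exp_add]
        congr 1
        ring
    _ = _ := by
        rw [lintegral_const_mul' _ _ ENNReal.ofReal_ne_top,
          ← ofReal_integral_eq_lintegral_ofReal (integrable_exp_neg_mul_sq hb')
            (ae_of_all _ fun x => Real.exp_nonneg _), ← ENNReal.ofReal_mul (by positivity)]
        congr 1
        ring

/-- Data whose noise on `S` and whose values off `S` have typical size, up to a factor `ℓ`. -/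
def typicalData {n : ℕ} (S : Finset (Fin n)) (θs : Fin n → ℝ) (ℓ : ℝ) : Set (Fin n → ℝ) :=
  {y | ∑ i ∈ S, (y i - θs i) ^ 2 ≤ S.card * ℓ ∧ ∑ i ∈ Sᶜ, |y i| ≤ n * ℓ}

theorem measurableSet_typicalData {n : ℕ} (S : Finset (Fin n)) (θs : Fin n → ℝ) (ℓ : ℝ) :
    MeasurableSet (typicalData S θs ℓ) := by
  have h1 : Measurable fun y : Fin n → ℝ => ∑ i ∈ S, (y i - θs i) ^ 2 := by fun_prop
  have h2 : Measurable fun y : Fin n → ℝ => ∑ i ∈ Sᶜ, |y i| := by fun_prop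
  exact (measurableSet_le h1 measurable_const).inter (measurableSet_le h2 measurable_const)

theorem dataLaw_lt_sum_le {n : ℕ} (θs : Fin n → ℝ) (N : Finset (Fin n)) {f : Fin n → ℝ → ℝ}
    (hf : ∀ i, Measurable (f i)) (hf0 : ∀ i x, 0 ≤ f i x) {a m ℓ : ℝ} (hm : 0 < m) (hℓ : 0 < ℓ)
    (ha : 0 ≤ a) (hN : N.card ≤ m)
    (hfi : ∀ i ∈ N, ∫⁻ x, ENNReal.ofReal (f i x) ∂(gaussianReal (θs i) 1) ≤ ENNReal.ofReal a) :
    dataLaw θs {y | m * ℓ < ∑ i ∈ N, f i (y i)} ≤ ENNReal.ofReal (a / ℓ) := by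
  have hmℓ : 0 < m * ℓ := by positivity
  have hfm : ∀ i : Fin n, Measurable fun y : Fin n → ℝ => ENNReal.ofReal (f i (y i)) := fun i =>
    ((hf i).comp (measurable_pi_apply i)).ennreal_ofReal
  have hsub : {y : Fin n → ℝ | m * ℓ < ∑ i ∈ N, f i (y i)} ⊆
      {y | ENNReal.ofReal (m * ℓ) ≤ ∑ i ∈ N, ENNReal.ofReal (f i (y i))} := by
    intro y hy
    rw [mem_ofPred_eq, ← ENNReal.ofReal_sum_of_nonneg fun i _ => hf0 i _]
    exact ENNReal.ofReal_le_ofReal (le_of_lt hy)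
  refine (measure_mono hsub).trans ((meas_ge_le_lintegral_div
    (Finset.measurable_sum _ fun i _ => hfm i).aemeasurable (by simpa using hmℓ)
    ENNReal.ofReal_ne_top).trans ?_)
  refine ENNReal.div_le_of_le_mul ?_
  rw [lintegral_finsetSum _ fun i _ => hfm i]
  calc ∑ i ∈ N, ∫⁻ y, ENNReal.ofReal (f i (y i)) ∂(dataLaw θs)
      ≤ ∑ i ∈ N, ENNReal.ofReal a := by
        refine Finset.sum_le_sum fun i hi => ?_
        unfold dataLaw
        rw [lintegral_pi_eval (f := fun x => ENNReal.ofReal (f i x)) (hf i).ennreal_ofReal i]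
        exact hfi i hi
    _ = ENNReal.ofReal (N.card * a) := by
        rw [Finset.sum_const, nsmul_eq_mul, ENNReal.ofReal_mul (by positivity),
          ENNReal.ofReal_natCast]
    _ ≤ ENNReal.ofReal (a / ℓ) * ENNReal.ofReal (m * ℓ) := by
        rw [← ENNReal.ofReal_mul (by positivity)]
        apply ENNReal.ofReal_le_ofReal
        rw [show a / ℓ * (m * ℓ) = m * a by field_simp]
        gcongr

theorem dataLaw_typicalData_compl_le {n : ℕ} (S : Finset (Fin n)) (hS : 0 < S.card)
    (θs : Fin n → ℝ) (hθ : ∀ i ∉ S, θs i = 0) {ℓ : ℝ} (hℓ : 0 < ℓ) :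
    dataLaw θs (typicalData S θs ℓ)ᶜ ≤ ENNReal.ofReal (3 / ℓ) := by
  have hn : S.card ≤ n := by
    have := Finset.card_le_univ S
    rwa [Fintype.card_fin] at this
  have h1 : dataLaw θs {y | (S.card : ℝ) * ℓ < ∑ i ∈ S, (y i - θs i) ^ 2} ≤
      ENNReal.ofReal (1 / ℓ) :=
    dataLaw_lt_sum_le θs S (f := fun i x => (x - θs i) ^ 2) (fun i => by fun_prop)
      (fun i x => sq_nonneg _) (by exact_mod_cast hS) hℓ zero_le_one le_rfl
      fun i _ => by rw [lintegral_sq_sub_gaussianReal, ENNReal.ofReal_one]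
  -- The 2 comes from `|x| ≤ 1 + x²` and unit variance.
  have h2 : dataLaw θs {y | (n : ℝ) * ℓ < ∑ i ∈ Sᶜ, |y i|} ≤ ENNReal.ofReal (2 / ℓ) := by
    refine dataLaw_lt_sum_le θs Sᶜ (f := fun i x => |x|) (fun i => by fun_prop)
      (fun i x => abs_nonneg _) (by exact_mod_cast hS.trans_le hn) hℓ zero_le_two ?_ fun i hi => ?_
    · have := Finset.card_le_univ Sᶜ
      rw [Fintype.card_fin] at this
      exact_mod_cast this
    · rw [hθ i (Finset.mem_compl.1 hi)]
      calc ∫⁻ x, ENNReal.ofReal |x| ∂(gaussianReal 0 1)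
          ≤ ∫⁻ x, (1 + ENNReal.ofReal ((x - 0) ^ 2)) ∂(gaussianReal 0 1) := by
            refine lintegral_mono fun x => ?_
            rw [← ENNReal.ofReal_one, ← ENNReal.ofReal_add zero_le_one (sq_nonneg _)]
            apply ENNReal.ofReal_le_ofReal
            rw [sub_zero, ← sq_abs x]
            nlinarith [sq_nonneg (|x| - 1), abs_nonneg x]
        _ = ENNReal.ofReal 2 := by
            rw [lintegral_add_left measurable_const, lintegral_sq_sub_gaussianReal,
              lintegral_const, measure_univ, mul_one, ENNReal.ofReal_ofNat]
            exact one_add_one_eq_two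
  have hsub : (typicalData S θs ℓ)ᶜ ⊆ {y | (S.card : ℝ) * ℓ < ∑ i ∈ S, (y i - θs i) ^ 2} ∪
      {y | (n : ℝ) * ℓ < ∑ i ∈ Sᶜ, |y i|} := by
    intro y hy
    by_contra hcon
    simp only [mem_union, mem_ofPred_eq, not_or, not_lt] at hcon
    exact hy hcon
  refine (measure_mono hsub).trans ((measure_union_le _ _).trans ((add_le_add h1 h2).trans ?_))
  rw [← ENNReal.ofReal_add (by positivity) (by positivity)]
  apply ENNReal.ofReal_le_ofReal
  apply le_of_eq
  ring

/-- Weighted arithmetic-geometric mean: a fraction `γ` of the squared distance is given up against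
`1/γ` times the noise. With noise of smaller order than the distance, `γ` may be a small constant.
-/
theorem sum_sq_sub_ge {ι : Type*} (S : Finset ι) (θ θs y : ι → ℝ) {γ a b : ℝ} (hγ : 0 < γ)
    (hγ1 : γ ≤ 1) (ha : a ≤ ∑ i ∈ S, (θ i - θs i) ^ 2) (hb : ∑ i ∈ S, (y i - θs i) ^ 2 ≤ b) :
    (1 - γ) * a - b / γ ≤ ∑ i ∈ S, (y i - θ i) ^ 2 := by
  have hpt : ∀ i ∈ S, (1 - γ) * (θ i - θs i) ^ 2 - (y i - θs i) ^ 2 / γ ≤ (y i - θ i) ^ 2 := by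
    intro i _
    have h1 : y i - θ i = (y i - θs i) - (θ i - θs i) := by ring
    rw [h1]
    set u := θ i - θs i
    set v := y i - θs i
    have h2 : 0 ≤ (γ * u - v) ^ 2 / γ := by positivity
    have h3 : (γ * u - v) ^ 2 / γ = γ * u ^ 2 - 2 * u * v + v ^ 2 / γ := by
      field_simp
      ring
    nlinarith [sq_nonneg v]
  have h4 := Finset.sum_le_sum hpt
  rw [Finset.sum_sub_distrib, ← Finset.mul_sum, ← Finset.sum_div] at h4
  have h5 : (1 - γ) * a ≤ (1 - γ) * ∑ i ∈ S, (θ i - θs i) ^ 2 :=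
    mul_le_mul_of_nonneg_left ha (by linarith)
  have h6 : (∑ i ∈ S, (y i - θs i) ^ 2) / γ ≤ b / γ := by gcongr
  linarith

/-! ### Hyperprior masses and the limit of the posterior mass -/

theorem ofReal_exp_le_of_negLogMass_div_lt {μ : Measure ℝ} {U : Set ℝ} {x ε : ℝ} (hx : 0 < x)
    (h : negLogMass μ U / (x : EReal) < (ε : EReal)) :
    ENNReal.ofReal (Real.exp (-(ε * x))) ≤ μ U := by
  rw [EReal.div_lt_iff (by exact_mod_cast hx) (EReal.coe_ne_top x), negLogMass] at h
  rw [← ENNReal.log_le_log_iff, ENNReal.log_ofReal_of_pos (Real.exp_pos _), Real.log_exp,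
    EReal.coe_neg, EReal.coe_mul]
  exact EReal.neg_le.1 h.le

theorem le_ofReal_exp_of_lt_negLogMass_div {μ : Measure ℝ} {U : Set ℝ} {x K : ℝ} (hx : 0 < x)
    (h : (K : EReal) < negLogMass μ U / (x : EReal)) :
    μ U ≤ ENNReal.ofReal (Real.exp (-(K * x))) := by
  rw [EReal.lt_div_iff (by exact_mod_cast hx) (EReal.coe_ne_top x), negLogMass] at h
  rw [← ENNReal.log_le_log_iff, ENNReal.log_ofReal_of_pos (Real.exp_pos _), Real.log_exp,
    EReal.coe_neg, EReal.coe_mul]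
  exact EReal.le_neg_of_le_neg h.le

/-- The support of a mean vector. -/
noncomputable def signalSet {n : ℕ} (θs : Fin n → ℝ) : Finset (Fin n) :=
  Finset.univ.filter fun j : Fin n => θs j ≠ 0

theorem eq_zero_of_notMem_signalSet {n : ℕ} (θs : Fin n → ℝ) : ∀ i ∉ signalSet θs, θs i = 0 := by
  intro i hi
  simpa [signalSet] using hi

theorem tendsto_log_div_atTop {s : ℕ → ℕ} (hs_pos : ∀ᶠ n in atTop, 1 ≤ s n)
    (hs : (fun n : ℕ => (s n : ℝ)) =o[atTop] fun n : ℕ => (n : ℝ)) :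
    Tendsto (fun n : ℕ => (s n : ℝ) / n) atTop (𝓝[>] 0) ∧
    Tendsto (fun n : ℕ => Real.log ((n : ℝ) / s n)) atTop atTop := by
  have h1 : Tendsto (fun n : ℕ => (s n : ℝ) / n) atTop (𝓝[>] 0) := by
    refine tendsto_nhdsWithin_iff.2 ⟨hs.tendsto_div_nhds_zero, ?_⟩
    filter_upwards [hs_pos, eventually_gt_atTop 0] with n hn hn0
    have h0 : (0 : ℝ) < s n := Nat.cast_pos.2 hn
    have h1 : (0 : ℝ) < n := Nat.cast_pos.2 hn0
    exact div_pos h0 h1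
  refine ⟨h1, ?_⟩
  have h2 := Real.tendsto_log_atTop.comp h1.inv_tendsto_nhdsGT_zero
  refine h2.congr fun n => ?_
  simp [inv_div]

theorem eventually_add_mul_sqrt_le {C D ε : ℝ} (hε : 0 < ε) :
    ∀ᶠ x in atTop, C + D * √x ≤ ε * x := by
  have h1 : ∀ᶠ x : ℝ in atTop, 2 * C / ε ≤ x := eventually_ge_atTop _
  have h2 : ∀ᶠ x : ℝ in atTop, 2 * |D| / ε ≤ √x :=
    Real.tendsto_sqrt_atTop.eventually_ge_atTop _
  filter_upwards [h1, h2, eventually_ge_atTop 0] with x hx1 hx2 hx0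
  rw [div_le_iff₀ hε] at hx1 hx2
  have h3 : √x * √x = x := Real.mul_self_sqrt hx0
  have h4 : D * √x ≤ |D| * √x := mul_le_mul_of_nonneg_right (le_abs_self D) (Real.sqrt_nonneg x)
  have h5 : 2 * |D| * √x ≤ √x * ε * √x := mul_le_mul_of_nonneg_right hx2 (Real.sqrt_nonneg x)
  nlinarith

theorem inv_ofReal_exp_mul_ofReal_exp_le {a b c : ℝ} (h : a + b ≤ c) :
    (ENNReal.ofReal (Real.exp (-a)))⁻¹ * ENNReal.ofReal (Real.exp (-c)) ≤
      ENNReal.ofReal (Real.exp (-b)) := by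
  rw [← ENNReal.ofReal_inv_of_pos (Real.exp_pos _), ← Real.exp_neg,
    ← ENNReal.ofReal_mul (Real.exp_nonneg _), ← Real.exp_add]
  apply ENNReal.ofReal_le_ofReal
  apply Real.exp_le_exp.2
  linarith

/-- Posterior mass of sets on which either the null coordinates or the signal coordinates are
far from the truth. -/
theorem tendsto_expectedPosteriorProb_zero {ω α : ℝ} (hω : 0 < ω) (hα : 1 < α)
    {π₀ : ℝ → ℝ} (hπ₀ : IsPolynomialTailDensity π₀ α)
    {s : ℕ → ℕ} (hs_pos : ∀ᶠ n in atTop, 1 ≤ s n)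
    (hs : (fun n : ℕ => (s n : ℝ)) =o[atTop] fun n : ℕ => (n : ℝ))
    {θs : ∀ n, Fin n → ℝ} (hθs : ∀ n, (signalSet (θs n)).card = s n)
    (hθs_le : ∀ᶠ n : ℕ in atTop, ∀ j, |θs n j| ≤ ((n : ℝ) / s n) ^ (ω / (5 * α)))
    {ν : ℕ → Measure ℝ} (hν : IsAdaptiveHyperprior ω α s ν) {η : ℝ} (hη : 0 < η)
    {A : ∀ n, Set (Fin n → ℝ)}
    (hA : ∀ᶠ n : ℕ in atTop, ∀ θ ∈ A n,
      η * (s n * √(Real.log ((n : ℝ) / s n))) ≤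
        ∑ i ∈ (signalSet (θs n))ᶜ, (|θ i| + θ i ^ 2) ∨
      (2 + 3 / 2 * ω) * (s n * Real.log ((n : ℝ) / s n)) ≤
        ∑ i ∈ signalSet (θs n), (θ i - θs n i) ^ 2) :
    Tendsto (fun n => expectedPosteriorProb π₀ (ν n) (θs n) (A n)) atTop (𝓝 0) := by
  obtain ⟨G, b, r₁, hG, hb0, hb, hr₁, hmom⟩ := hπ₀.exists_lintegral_abs_add_sq_le hα
  obtain ⟨B, hB, hBint⟩ := exists_lintegral_exp_mul_sq_le hG hb
  obtain ⟨C, r₂, hr₂, hden⟩ := hπ₀.exists_le_lintegral_prod_marginalDensity hα hω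
  obtain ⟨hr_tend, hL_tend⟩ := tendsto_log_div_atTop hs_pos hs
  have hα1 : 0 < α - 1 := by linarith
  -- Chosen to lower `2 + 3ω/2` by exactly `ω/20`; half of the result is `1 + 29ω/40`, still above
  -- the cost `1 + 7ω/10` of the denominator.
  set γ := ω / 20 / (2 + 3 / 2 * ω) with hγ
  have hγ0 : 0 < γ := by positivity
  have hγ1 : γ ≤ 1 := by
    rw [hγ, div_le_one (by positivity)]
    linarith
  have hγK : (1 - γ) * (2 + 3 / 2 * ω) = 2 + 29 / 20 * ω := by
    rw [hγ]
    field_simp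
    ring
  set bound : ℕ → ℝ≥0∞ := fun n => ENNReal.ofReal (3 / √(Real.log ((n : ℝ) / s n))) +
    (ENNReal.ofReal (B / (η * √(Real.log ((n : ℝ) / s n)))) +
      (ENNReal.ofReal (Real.exp (-(ω / 100 * Real.log ((n : ℝ) / s n)))) +
        ENNReal.ofReal (Real.exp (-(ω / 100 * Real.log ((n : ℝ) / s n)))))) with hbound
  have hbound0 : Tendsto bound atTop (𝓝 0) := by
    have hsq := Real.tendsto_sqrt_atTop.comp hL_tend
    have e1 : Tendsto (fun n : ℕ => ENNReal.ofReal (3 / √(Real.log ((n : ℝ) / s n)))) atTop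
        (𝓝 0) := by
      rw [← ENNReal.ofReal_zero]
      exact ENNReal.tendsto_ofReal (hsq.const_div_atTop 3)
    have e2 : Tendsto (fun n : ℕ => ENNReal.ofReal (B / (η * √(Real.log ((n : ℝ) / s n)))))
        atTop (𝓝 0) := by
      rw [← ENNReal.ofReal_zero]
      exact ENNReal.tendsto_ofReal ((hsq.const_mul_atTop hη).const_div_atTop B)
    have e3 : Tendsto (fun n : ℕ => ENNReal.ofReal
        (Real.exp (-(ω / 100 * Real.log ((n : ℝ) / s n))))) atTop (𝓝 0) := by
      rw [← ENNReal.ofReal_zero]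
      refine ENNReal.tendsto_ofReal (Real.tendsto_exp_atBot.comp (tendsto_neg_atTop_atBot.comp ?_))
      exact hL_tend.const_mul_atTop (by positivity)
    simpa using e1.add (e2.add (e3.add e3))
  have hopt : ∀ᶠ n : ℕ in atTop, negLogMass (ν n) (Icc (((s n : ℝ) / n) ^ ((1 + ω / 2) / (α - 1)))
      (((s n : ℝ) / n) ^ (α / (α - 1)))) / (((s n : ℝ) * Real.log ((n : ℝ) / s n) : ℝ) : EReal) <
      ((ω / 200 : ℝ) : EReal) :=
    hν.mass_optimal.eventually_lt_const (by exact_mod_cast (by positivity : 0 < ω / 200))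
  -- Any rate above `1 + 29ω/40` would do; large scales then need no estimate beyond the one for
  -- `E`.
  have hlarge : ∀ᶠ n : ℕ in atTop, ((1 + ω : ℝ) : EReal) <
      negLogMass (ν n) (Ici (((s n : ℝ) / n) ^ (α / (α - 1)))) /
      (((s n : ℝ) * Real.log ((n : ℝ) / s n) : ℝ) : EReal) :=
    hν.mass_large.eventually_const_lt (EReal.coe_lt_top _)
  refine tendsto_of_tendsto_of_tendsto_of_le_of_le' tendsto_const_nhds hbound0
    (Eventually.of_forall fun n => zero_le) ?_
  filter_upwards [hs_pos, eventually_gt_atTop 0, hθs_le, hν.isProbabilityMeasure, hν.pos, hA,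
    hopt, hlarge, hL_tend.eventually_gt_atTop 0,
    hL_tend.eventually (eventually_add_mul_sqrt_le (C := C) (D := 1 + α + 1 / (2 * γ))
      (ε := ω / 200) (by positivity)),
    hr_tend.eventually (Ioc_mem_nhdsGT (lt_min hr₁ hr₂))]
    with n hsn hn hθ hprob hpos hAn hoptn hlargen hL hdom hr
  have hs1 : (1 : ℝ) ≤ s n := by exact_mod_cast hsn
  have hn0 : (0 : ℝ) < n := by exact_mod_cast hn
  set r := (s n : ℝ) / n with hrdef
  set L := Real.log ((n : ℝ) / s n) with hLdef
  -- Diverges, so data are typical with probability tending to 1, yet is `o(L)`, so noise terms are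
  -- of lower order in the exponents.
  set ℓ := √L with hℓ
  have hℓ0 : 0 < ℓ := Real.sqrt_pos.2 hL
  have hrinv : r⁻¹ = (n : ℝ) / s n := by rw [hrdef, inv_div]
  have hlogr : -Real.log r = L := by rw [← Real.log_inv, hrinv]
  have hnr : (n : ℝ) * r = (signalSet (θs n)).card := by
    rw [hθs n, hrdef]
    field_simp
  have hsL : 0 < (s n : ℝ) * L := by positivity
  have hνopt := ofReal_exp_le_of_negLogMass_div_lt hsL hoptn
  have hνlarge := le_ofReal_exp_of_lt_negLogMass_div hsL hlargen
  set a := (s n : ℝ) * ((1 + 7 * ω / 10) * L + C + (1 + α) * ℓ) with ha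
  set E := (s n : ℝ) * ((1 + 29 / 40 * ω) * L - ℓ / (2 * γ)) with hE
  have hmain := hπ₀.expectedPosteriorProb_le (ν n) hpos (signalSet (θs n)) (θs n)
    (eq_zero_of_notMem_signalSet _) (T := r ^ (α / (α - 1))) (E := E)
    (κ := η * (s n * ℓ)) (d := Real.exp (-(a + ω / 200 * (s n * L)))) (by positivity)
    (Real.exp_pos _) (g := fun x => ENNReal.ofReal (r * (G * Real.exp (b * x ^ 2))))
    (by fun_prop) (A := A n) (measurableSet_typicalData (signalSet (θs n)) (θs n) ℓ)
    (fun y hy θ hθA => by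
      rcases hAn θ hθA with h | h
      · exact Or.inl h
      · right
        have h1 := sum_sq_sub_ge _ θ (θs n) y hγ0 hγ1 h hy.1
        rw [hθs n, ← mul_assoc (1 - γ), hγK] at h1
        refine le_trans (le_of_eq ?_) h1
        rw [hE]
        field_simp
        ring)
    (fun τ x hτ hτT => hmom r τ x hr.1 (hr.2.trans (min_le_left _ _)) hτ hτT.le)
    (fun y hy => by
      have h1 := hden n (signalSet (θs n)) (θs n) y (ν n) r ℓ hr.1 (hr.2.trans (min_le_right _ _))
        hnr (by rw [hrinv]; exact hθ) hy.1 hy.2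
      rw [hθs n, hlogr] at h1
      refine le_trans (mul_le_mul' ?_ le_rfl) h1
      rw [neg_add, Real.exp_add, ENNReal.ofReal_mul (Real.exp_nonneg _)]
      exact mul_le_mul' le_rfl hνopt)
  refine hmain.trans ?_
  rw [hbound]
  -- The margin `29ω/40 - 7ω/10 = ω/40` pays `ω/200` for the hyperprior mass, `ω/200` for the
  -- lower-order terms and `ω/100` for the remaining decay.
  have hgap : a + ω / 200 * (s n * L) + ω / 100 * L ≤ E := by
    have h1 : ω / 100 * L ≤ s n * (ω / 100 * L) := le_mul_of_one_le_left (by positivity) hs1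
    have h2 : (s n : ℝ) * (C + (1 + α + 1 / (2 * γ)) * ℓ) ≤ s n * (ω / 200 * L) := by
      gcongr
    have h3 : ℓ / (2 * γ) = 1 / (2 * γ) * ℓ := by ring
    have h4 : 0 ≤ (s n : ℝ) * (ω * L) := by positivity
    rw [ha, hE, h3]
    nlinarith
  have hgap' : a + ω / 200 * (s n * L) + ω / 100 * L ≤ (1 + ω) * (s n * L) := by
    have h1 : E ≤ (1 + ω) * (s n * L) := by
      have h2 : 0 ≤ (s n : ℝ) * (ℓ / (2 * γ)) := by positivity
      have h4 : 0 ≤ (s n : ℝ) * (ω * L) := by positivity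
      rw [hE]
      nlinarith
    linarith
  refine add_le_add ?_ (add_le_add ?_ ?_)
  · exact dataLaw_typicalData_compl_le _ (by rw [hθs n]; exact hsn) _
      (eq_zero_of_notMem_signalSet _) hℓ0
  · refine (mul_le_mul' le_rfl (mul_le_mul' le_rfl (hBint r hr.1))).trans ?_
    rw [← ENNReal.ofReal_inv_of_pos (by positivity), ← ENNReal.ofReal_natCast,
      ← ENNReal.ofReal_mul (by positivity), ← ENNReal.ofReal_mul (by positivity)]
    apply ENNReal.ofReal_le_ofReal
    change (η * (s n * ℓ))⁻¹ * (n * (r * B)) ≤ B / (η * ℓ)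
    rw [hrdef]
    apply le_of_eq
    field_simp
  · rw [mul_add]
    refine add_le_add ?_ (inv_ofReal_exp_mul_ofReal_exp_le hgap)
    exact (mul_le_mul' le_rfl hνlarge).trans (inv_ofReal_exp_mul_ofReal_exp_le hgap')

/-! ### From the two norms to the two bad events -/

theorem constL2_sq_gt {ω : ℝ} (hω : 0 < ω) : 2 + 3 / 2 * ω < constL2 ω ^ 2 := by
  unfold constL2
  have h1 : √(2 + ω) ^ 2 = 2 + ω := Real.sq_sqrt (by linarith)
  have h2 : √ω ^ 2 = ω := Real.sq_sqrt hω.le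
  have h3 : 0 ≤ √(2 + ω) * √ω := by positivity
  nlinarith

/-- Squaring `√(2+ω) + ω/√5` gives `2 + ω` plus a cross term of at least `4ω/5`, more than the
missing `ω/2`. The summand `√(ω/5)` makes the inequality strict. -/
theorem sqrt_lt_constL1 {ω : ℝ} (hω : 0 < ω) : √(2 + 3 / 2 * ω) < constL1 ω := by
  have h3 : √(ω ^ 2 / 5) = ω * √(1 / 5) := by
    rw [show ω ^ 2 / 5 = ω ^ 2 * (1 / 5) by ring, Real.sqrt_mul (sq_nonneg _), Real.sqrt_sq hω.le]
  have h4 : 0 < √(ω / 5) := Real.sqrt_pos.2 (by positivity)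
  have h5 : 2 / 5 ≤ √(1 / 5 : ℝ) := by
    rw [Real.le_sqrt' (by norm_num)]
    norm_num
  have h6 : 1 ≤ √(2 + ω) := by
    rw [Real.one_le_sqrt]
    linarith
  have h7 : √(2 + 3 / 2 * ω) ≤ √(2 + ω) + ω * √(1 / 5) := by
    rw [Real.sqrt_le_left (by positivity)]
    have h1 : √(2 + ω) ^ 2 = 2 + ω := Real.sq_sqrt (by linarith)
    have h8 : 2 / 5 * 1 ≤ √(1 / 5) * √(2 + ω) := by gcongr
    have h9 : ω * (2 / 5 * 1) ≤ ω * (√(1 / 5) * √(2 + ω)) := by gcongr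
    nlinarith [sq_nonneg (ω * √(1 / 5))]
  unfold constL1
  rw [h3]
  linarith

section Deterministic

variable {n : ℕ} {θ θs : Fin n → ℝ} {η ℓ : ℝ}

theorem sum_compl_signalSet (f : ℝ → ℝ) (θ θs : Fin n → ℝ) :
    ∑ i ∈ (signalSet θs)ᶜ, f (θ i - θs i) = ∑ i ∈ (signalSet θs)ᶜ, f (θ i) := by
  refine Finset.sum_congr rfl fun i hi => ?_
  rw [eq_zero_of_notMem_signalSet θs i (Finset.mem_compl.1 hi), sub_zero]

/-- If both sums were small, the squared norm would fall below `(K + η) s ℓ²`. The null threshold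
has order `s ℓ`, which `ℓ ≥ 1` bounds by `s ℓ²`. -/
theorem far_of_le_norm_two {s K c : ℝ} (hℓ : 1 ≤ ℓ) (hη : 0 < η) (hs : 0 ≤ s) (hc : 0 ≤ c)
    (hK : K + η ≤ c ^ 2) (h : c * √(s * ℓ ^ 2) ≤ ‖WithLp.toLp 2 (θ - θs)‖) :
    η * (s * ℓ) ≤ ∑ i ∈ (signalSet θs)ᶜ, (|θ i| + θ i ^ 2) ∨
      K * (s * ℓ ^ 2) ≤ ∑ i ∈ signalSet θs, (θ i - θs i) ^ 2 := by
  by_contra! hcon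
  obtain ⟨h1, h2⟩ := hcon
  have h3 : (c * √(s * ℓ ^ 2)) ^ 2 ≤ ‖WithLp.toLp 2 (θ - θs)‖ ^ 2 := by gcongr
  rw [EuclideanSpace.norm_sq_eq, mul_pow, Real.sq_sqrt (by positivity)] at h3
  simp only [Pi.sub_apply, Real.norm_eq_abs, sq_abs] at h3
  rw [← Finset.sum_add_sum_compl (signalSet θs), sum_compl_signalSet (fun x => x ^ 2)] at h3
  have h4 : ∑ i ∈ (signalSet θs)ᶜ, θ i ^ 2 ≤ ∑ i ∈ (signalSet θs)ᶜ, (|θ i| + θ i ^ 2) :=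
    Finset.sum_le_sum fun i _ => by linarith [abs_nonneg (θ i)]
  have h5 : η * (s * ℓ) ≤ η * (s * ℓ ^ 2) := by
    have : ℓ ≤ ℓ ^ 2 := by nlinarith
    gcongr
  have h6 : (K + η) * (s * ℓ ^ 2) ≤ c ^ 2 * (s * ℓ ^ 2) :=
    mul_le_mul_of_nonneg_right hK (by positivity)
  linarith

/-- On the support, Cauchy-Schwarz over its `s` coordinates turns a squared error below `K s ℓ²`
into an `L₁` error below `√K s ℓ`; the null coordinates add less than `η s ℓ`. -/
theorem far_of_le_norm_one {K c : ℝ} (hℓ : 0 ≤ ℓ) (hK : 0 ≤ K) (hKc : √K + η ≤ c)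
    (hs : 0 < (signalSet θs).card)
    (h : (signalSet θs).card * c * ℓ ≤ ‖WithLp.toLp 1 (θ - θs)‖) :
    η * ((signalSet θs).card * ℓ) ≤ ∑ i ∈ (signalSet θs)ᶜ, (|θ i| + θ i ^ 2) ∨
      K * ((signalSet θs).card * ℓ ^ 2) ≤ ∑ i ∈ signalSet θs, (θ i - θs i) ^ 2 := by
  by_contra! hcon
  obtain ⟨h1, h2⟩ := hcon
  set s := ((signalSet θs).card : ℝ) with hsdef
  have hs0 : 0 < s := Nat.cast_pos.2 hs
  rw [PiLp.norm_eq_of_L1] at h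
  simp only [Pi.sub_apply, Real.norm_eq_abs] at h
  rw [← Finset.sum_add_sum_compl (signalSet θs), sum_compl_signalSet (fun x => |x|)] at h
  have h4 : ∑ i ∈ (signalSet θs)ᶜ, |θ i| ≤ ∑ i ∈ (signalSet θs)ᶜ, (|θ i| + θ i ^ 2) :=
    Finset.sum_le_sum fun i _ => by linarith [sq_nonneg (θ i)]
  have h5 : (∑ i ∈ signalSet θs, |θ i - θs i|) ^ 2 ≤
      s * ∑ i ∈ signalSet θs, (θ i - θs i) ^ 2 := by
    have := sq_sum_le_card_mul_sum_sq (s := signalSet θs) (f := fun i => |θ i - θs i|)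
    simpa only [sq_abs] using this
  have h6 : s * (√K + η) * ℓ ≤ s * c * ℓ := by gcongr
  have h7 : s * √K * ℓ < ∑ i ∈ signalSet θs, |θ i - θs i| := by linarith
  have h8 : (s * √K * ℓ) ^ 2 < (∑ i ∈ signalSet θs, |θ i - θs i|) ^ 2 := by gcongr
  rw [mul_pow, mul_pow, Real.sq_sqrt hK] at h8
  have h9 : s * ∑ i ∈ signalSet θs, (θ i - θs i) ^ 2 < s * (K * (s * ℓ ^ 2)) := by gcongr
  nlinarith

end Deterministic

/-! ### Limits of the constants and the two contractions -/

theorem tendsto_constL2 : Tendsto constL2 (𝓝[>] 0) (𝓝 √2) := by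
  have h : ContinuousAt constL2 0 := by
    unfold constL2
    fun_prop
  have h0 : constL2 0 = √2 := by simp [constL2]
  rw [← h0]
  exact h.tendsto.mono_left nhdsWithin_le_nhds

theorem tendsto_constL1 : Tendsto constL1 (𝓝[>] 0) (𝓝 √2) := by
  have h : ContinuousAt constL1 0 := by
    unfold constL1
    fun_prop
  have h0 : constL1 0 = √2 := by simp [constL1]
  rw [← h0]
  exact h.tendsto.mono_left nhdsWithin_le_nhds

section Contraction

variable {ω α : ℝ} {π₀ : ℝ → ℝ} {s : ℕ → ℕ} {θs : ∀ n, Fin n → ℝ} {ν : ℕ → Measure ℝ}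

theorem contractsL2_of_isAdaptiveHyperprior (hω : 0 < ω) (hα : 1 < α)
    (hπ₀ : IsPolynomialTailDensity π₀ α) (hs_pos : ∀ᶠ n in atTop, 1 ≤ s n)
    (hs : (fun n : ℕ => (s n : ℝ)) =o[atTop] fun n : ℕ => (n : ℝ))
    (hθs : ∀ n, (signalSet (θs n)).card = s n)
    (hθs_le : ∀ᶠ n : ℕ in atTop, ∀ j, |θs n j| ≤ ((n : ℝ) / s n) ^ (ω / (5 * α)))
    (hν : IsAdaptiveHyperprior ω α s ν) : ContractsL2 ω π₀ s θs ν := by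
  refine tendsto_expectedPosteriorProb_zero hω hα hπ₀ hs_pos hs hθs hθs_le hν
    (η := constL2 ω ^ 2 - (2 + 3 / 2 * ω)) (by linarith [constL2_sq_gt hω]) ?_
  filter_upwards [(tendsto_log_div_atTop hs_pos hs).2.eventually_ge_atTop 1] with n hL θ hθ
  have hsq : √(Real.log ((n : ℝ) / s n)) ^ 2 = Real.log ((n : ℝ) / s n) :=
    Real.sq_sqrt (by linarith)
  have h := far_of_le_norm_two (θ := θ) (θs := θs n) (ℓ := √(Real.log ((n : ℝ) / s n)))
    (η := constL2 ω ^ 2 - (2 + 3 / 2 * ω)) (s := s n) (K := 2 + 3 / 2 * ω) (c := constL2 ω)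
    (Real.one_le_sqrt.2 hL) (by linarith [constL2_sq_gt hω]) (by positivity)
    (by unfold constL2; positivity) (by linarith) (by rw [hsq]; exact hθ)
  rwa [hsq] at h

theorem contractsL1_of_isAdaptiveHyperprior (hω : 0 < ω) (hα : 1 < α)
    (hπ₀ : IsPolynomialTailDensity π₀ α) (hs_pos : ∀ᶠ n in atTop, 1 ≤ s n)
    (hs : (fun n : ℕ => (s n : ℝ)) =o[atTop] fun n : ℕ => (n : ℝ))
    (hθs : ∀ n, (signalSet (θs n)).card = s n)
    (hθs_le : ∀ᶠ n : ℕ in atTop, ∀ j, |θs n j| ≤ ((n : ℝ) / s n) ^ (ω / (5 * α)))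
    (hν : IsAdaptiveHyperprior ω α s ν) : ContractsL1 ω π₀ s θs ν := by
  refine tendsto_expectedPosteriorProb_zero hω hα hπ₀ hs_pos hs hθs hθs_le hν
    (η := constL1 ω - √(2 + 3 / 2 * ω)) (by linarith [sqrt_lt_constL1 hω]) ?_
  filter_upwards [(tendsto_log_div_atTop hs_pos hs).2.eventually_ge_atTop 1, hs_pos]
    with n hL hsn θ hθ
  have hsq : √(Real.log ((n : ℝ) / s n)) ^ 2 = Real.log ((n : ℝ) / s n) :=
    Real.sq_sqrt (by linarith)
  have h := far_of_le_norm_one (θ := θ) (θs := θs n) (ℓ := √(Real.log ((n : ℝ) / s n)))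
    (η := constL1 ω - √(2 + 3 / 2 * ω)) (K := 2 + 3 / 2 * ω) (c := constL1 ω)
    (Real.sqrt_nonneg _) (by positivity) (by linarith) (by rw [hθs n]; exact hsn)
    (by rw [hθs n]; exact hθ)
  rwa [hsq, hθs n] at h

end Contraction

/-! ### The Beta hyperprior -/

theorem beta_one_natCast {n : ℕ} (hn : 0 < n) : beta 1 n = 1 / n := by
  have h0 : (0 : ℝ) < n := Nat.cast_pos.2 hn
  have h1 : Real.Gamma n ≠ 0 := (Real.Gamma_pos_of_pos h0).ne'
  rw [beta, Real.Gamma_one, one_mul, add_comm, Real.Gamma_add_one h0.ne']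
  field_simp

theorem betaPDF_one_natCast {n : ℕ} (hn : 0 < n) {t : ℝ} (ht0 : 0 < t) (ht1 : t < 1) :
    betaPDF 1 n t = ENNReal.ofReal (n * (1 - t) ^ (n - 1)) := by
  rw [betaPDF_of_pos_lt_one ht0 ht1, beta_one_natCast hn, one_div_one_div, sub_self,
    Real.rpow_zero, mul_one, ← Nat.cast_pred hn, Real.rpow_natCast]

/-- The density `n (1-t)^(n-1)` is at least `n exp (-2nr)` on this interval of length `r/2`. At `r =
s/n` the negative log mass is `O(s)`, of smaller order than `s log (n/s)`. -/
theorem le_betaMeasure_one_Icc {n : ℕ} (hn : 0 < n) {r : ℝ} (hr : 0 < r) (hr2 : r ≤ 1 / 2) :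
    ENNReal.ofReal (n * (r / 2) * Real.exp (-(2 * (n * r)))) ≤
      betaMeasure 1 n (Icc (r / 2) r) := by
  rw [betaMeasure, withDensity_apply _ measurableSet_Icc]
  calc ENNReal.ofReal (n * (r / 2) * Real.exp (-(2 * (n * r))))
      = ∫⁻ t in Icc (r / 2) r, ENNReal.ofReal (n * Real.exp (-(2 * (n * r)))) := by
        rw [setLIntegral_const, Real.volume_Icc, ← ENNReal.ofReal_mul (by positivity)]
        congr 1
        ring
    _ ≤ ∫⁻ t in Icc (r / 2) r, betaPDF 1 n t := by
        refine setLIntegral_mono' measurableSet_Icc fun t ht => ?_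
        have ht0 : 0 < t := lt_of_lt_of_le (by positivity) ht.1
        have ht2 : t ≤ 1 / 2 := ht.2.trans hr2
        rw [betaPDF_one_natCast hn ht0 (by linarith)]
        apply ENNReal.ofReal_le_ofReal
        gcongr
        calc Real.exp (-(2 * (n * r))) = Real.exp (-(2 * r)) ^ n := by
              rw [← Real.exp_nat_mul]
              congr 1
              ring
          _ ≤ (1 - r) ^ n := by
              gcongr
              exact exp_neg_two_mul_le hr.le hr2
          _ ≤ (1 - t) ^ n := by
              have h1 : 1 - r ≤ 1 - t := by linarith [ht.2]
              have h2 : 0 ≤ 1 - r := by linarith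
              gcongr
          _ ≤ (1 - t) ^ (n - 1) :=
              pow_le_pow_of_le_one (by linarith) (by linarith) (Nat.sub_le n 1)

theorem betaMeasure_one_Iic_zero (n : ℕ) : betaMeasure 1 n (Iic 0) = 0 := by
  rw [betaMeasure, withDensity_apply _ measurableSet_Iic]
  exact setLIntegral_eq_zero measurableSet_Iic fun x hx => betaPDF_eq_zero_of_nonpos hx

theorem betaMeasure_one_Ici_le {n : ℕ} (hn : 0 < n) {x : ℝ} (hx : 0 < x) :
    betaMeasure 1 n (Ici x) ≤ ENNReal.ofReal (n * Real.exp (-(x * (n - 1)))) := by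
  rw [betaMeasure, withDensity_apply _ measurableSet_Ici]
  have hpt : ∀ t ∈ Ici x, betaPDF 1 n t ≤
      (Iio (1 : ℝ)).indicator (fun _ => ENNReal.ofReal (n * Real.exp (-(x * (n - 1))))) t := by
    intro t ht
    have ht0 : 0 < t := hx.trans_le ht
    by_cases ht1 : t < 1
    · rw [indicator_of_mem (by exact ht1), betaPDF_one_natCast hn ht0 ht1]
      apply ENNReal.ofReal_le_ofReal
      gcongr
      calc (1 - t) ^ (n - 1) ≤ Real.exp (-x) ^ (n - 1) := by
            have h1 : 1 - t ≤ Real.exp (-x) := by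
              have h2 : x ≤ t := ht
              linarith [Real.add_one_le_exp (-x)]
            have h3 : 0 ≤ 1 - t := by linarith
            gcongr
        _ = _ := by
            rw [← Real.exp_nat_mul, Nat.cast_pred hn]
            congr 1
            ring
    · rw [betaPDF_eq_zero_of_one_le (not_lt.1 ht1)]
      exact zero_le
  calc ∫⁻ t in Ici x, betaPDF 1 n t
      ≤ ∫⁻ t in Ici x, (Iio (1 : ℝ)).indicator
          (fun _ => ENNReal.ofReal (n * Real.exp (-(x * (n - 1))))) t :=
        setLIntegral_mono' measurableSet_Ici hpt
    _ = ENNReal.ofReal (n * Real.exp (-(x * (n - 1)))) * volume (Iio 1 ∩ Ici x) := by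
        rw [lintegral_indicator measurableSet_Iio, setLIntegral_const,
          Measure.restrict_apply measurableSet_Iio]
    _ ≤ ENNReal.ofReal (n * Real.exp (-(x * (n - 1)))) * 1 := by
        refine mul_le_mul' le_rfl ?_
        rw [inter_comm, Ici_inter_Iio, Real.volume_Ico, ← ENNReal.ofReal_one]
        apply ENNReal.ofReal_le_ofReal
        linarith
    _ = _ := mul_one _

theorem betaHyperprior_apply (c : ℝ) (n : ℕ) {U : Set ℝ} (hU : MeasurableSet U) :
    betaHyperprior c n U = betaMeasure 1 n {t | t ^ c ∈ U} :=
  Measure.map_apply (by fun_prop) hU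

theorem betaHyperprior_Iic_zero (c : ℝ) (n : ℕ) : betaHyperprior c n (Iic 0) = 0 := by
  rw [betaHyperprior_apply c n measurableSet_Iic]
  refine measure_mono_null (fun t ht => ?_) (betaMeasure_one_Iic_zero n)
  by_contra hcon
  have h1 : 0 < t ^ c := Real.rpow_pos_of_pos (not_le.1 hcon) c
  have h2 : t ^ c ≤ 0 := ht
  exact absurd h1 (not_lt.2 h2)

theorem isProbabilityMeasure_betaHyperprior (c : ℝ) {n : ℕ} (hn : 0 < n) :
    IsProbabilityMeasure (betaHyperprior c n) := by
  have := isProbabilityMeasureBeta one_pos (show (0 : ℝ) < n from Nat.cast_pos.2 hn)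
  exact Measure.isProbabilityMeasure_map (by fun_prop)

/-- The event that `τ₀` lies in `[s/(2n), s/n]` already suffices: `b ≤ c` handles the upper end and
`ha` the lower one. -/
theorem le_betaHyperprior_Icc {n s : ℕ} (hs : 1 ≤ s) (hn : 0 < n) {a b c : ℝ} (hc : 0 < c)
    (hbc : b ≤ c) (hr : (s : ℝ) / n ≤ 1 / 2) (ha : ((s : ℝ) / n) ^ a ≤ ((s : ℝ) / n / 2) ^ c) :
    ENNReal.ofReal (Real.exp (-(3 * s))) ≤
      betaHyperprior c n (Icc (((s : ℝ) / n) ^ a) (((s : ℝ) / n) ^ b)) := by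
  have hn0 : (0 : ℝ) < n := Nat.cast_pos.2 hn
  have hs1 : (1 : ℝ) ≤ s := by exact_mod_cast hs
  set r := (s : ℝ) / n with hrdef
  have hr0 : 0 < r := by positivity
  have hnr : n * r = s := by rw [hrdef]; field_simp
  rw [betaHyperprior_apply c n measurableSet_Icc]
  refine le_trans ?_ (measure_mono (s := Icc (r / 2) r) fun t ht => ⟨?_, ?_⟩)
  · refine le_trans (ENNReal.ofReal_le_ofReal ?_) (le_betaMeasure_one_Icc hn hr0 hr)
    rw [hnr, show n * (r / 2) = n * r / 2 by ring, hnr]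
    have h1 : Real.exp (-s) ≤ s / 2 := by
      have h2 : 2 ≤ Real.exp s := by linarith [Real.add_one_le_exp (s : ℝ)]
      rw [Real.exp_neg]
      calc (Real.exp s)⁻¹ ≤ 2⁻¹ := inv_anti₀ two_pos h2
        _ ≤ s / 2 := by linarith
    calc Real.exp (-(3 * s)) = Real.exp (-s) * Real.exp (-(2 * s)) := by
          rw [← Real.exp_add]
          congr 1
          ring
      _ ≤ _ := by gcongr
  · refine ha.trans ?_
    have h1 := ht.1
    gcongr
  · have ht0 : 0 < t := lt_of_lt_of_le (by positivity) ht.1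
    calc t ^ c ≤ r ^ c := by
          have h1 := ht.2
          gcongr
      _ ≤ r ^ b := Real.rpow_le_rpow_of_exponent_ge hr0 (by linarith) hbc

/-- The event reads `τ₀ ≥ x = (s/n)^(b/c)`, of probability at most `n exp (-x (n-1))`, and `x n = s
(n/s)^(1-b/c)`. For `b < c` this beats any multiple of `s log (n/s)`. The subtracted terms bound `x
≤ 1` and `log n ≤ s + log (n/s)`. -/
theorem betaHyperprior_Ici_le {n s : ℕ} (hs : 1 ≤ s) (hn : 0 < n) {b c : ℝ} (hc : 0 < c)
    (hb : 0 ≤ b) (hr : (s : ℝ) / n ≤ 1) :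
    betaHyperprior c n (Ici (((s : ℝ) / n) ^ b)) ≤ ENNReal.ofReal (Real.exp
      (-(s * Real.exp ((1 - b / c) * Real.log ((n : ℝ) / s)) - 1 - s - Real.log ((n : ℝ) / s)))) := by
  have hn0 : (0 : ℝ) < n := Nat.cast_pos.2 hn
  have hs0 : (0 : ℝ) < s := Nat.cast_pos.2 hs
  set r := (s : ℝ) / n with hrdef
  have hr0 : 0 < r := by positivity
  have hnr : n * r = s := by rw [hrdef]; field_simp
  have hlog : Real.log ((n : ℝ) / s) = -Real.log r := by rw [hrdef, ← Real.log_inv, inv_div]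
  set x := r ^ (b / c) with hx
  have hx0 : 0 < x := by positivity
  have hx1 : x ≤ 1 := Real.rpow_le_one hr0.le hr (by positivity)
  rw [betaHyperprior_apply c n measurableSet_Ici]
  -- Nonpositive `t` are set aside because real powers of a negative base do not follow the order;
  -- they have Beta mass 0.
  have hsub : {t : ℝ | t ^ c ∈ Ici (r ^ b)} ⊆ Iic 0 ∪ Ici x := by
    intro t ht
    rcases le_or_gt t 0 with h0 | h0
    · exact Or.inl h0
    · right
      have h1 : r ^ b ≤ t ^ c := ht
      have h2 : x ^ c ≤ t ^ c := by rwa [hx, ← Real.rpow_mul hr0.le, div_mul_cancel₀ _ hc.ne']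
      exact (Real.rpow_le_rpow_iff hx0.le h0.le hc).1 h2
  refine (measure_mono hsub).trans ((measure_union_le _ _).trans ?_)
  rw [betaMeasure_one_Iic_zero, zero_add]
  refine (betaMeasure_one_Ici_le hn hx0).trans (ENNReal.ofReal_le_ofReal ?_)
  have hlogn : Real.log n ≤ s + Real.log ((n : ℝ) / s) := by
    rw [Real.log_div hn0.ne' hs0.ne']
    linarith [Real.log_le_self hs0.le]
  have hxn : x * n = s * Real.exp ((1 - b / c) * Real.log ((n : ℝ) / s)) := by
    rw [hlog, ← hnr, hx, Real.rpow_def_of_pos hr0]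
    have h1 : r * Real.exp ((1 - b / c) * -Real.log r) = Real.exp (Real.log r * (b / c)) := by
      nth_rw 1 [← Real.exp_log hr0]
      rw [← Real.exp_add]
      congr 1
      ring
    rw [mul_assoc, h1, mul_comm]
  calc (n : ℝ) * Real.exp (-(x * (n - 1)))
      = Real.exp (Real.log n + -(x * (n - 1))) := by rw [Real.exp_add, Real.exp_log hn0]
    _ ≤ _ := by
      apply Real.exp_le_exp.2
      rw [← hxn]
      linarith

theorem negLogMass_le {μ : Measure ℝ} {U : Set ℝ} {x : ℝ}
    (h : ENNReal.ofReal (Real.exp (-x)) ≤ μ U) : negLogMass μ U ≤ x := by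
  rw [← ENNReal.log_le_log_iff, ENNReal.log_ofReal_of_pos (Real.exp_pos _), Real.log_exp,
    EReal.coe_neg] at h
  exact EReal.neg_le.1 h

theorem le_negLogMass {μ : Measure ℝ} {U : Set ℝ} {x : ℝ}
    (h : μ U ≤ ENNReal.ofReal (Real.exp (-x))) : x ≤ negLogMass μ U := by
  rw [← ENNReal.log_le_log_iff, ENNReal.log_ofReal_of_pos (Real.exp_pos _), Real.log_exp,
    EReal.coe_neg] at h
  exact EReal.le_neg_of_le_neg h

theorem isAdaptiveHyperprior_betaHyperprior {ω α c : ℝ} (hα : 1 < α)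
    (hc : c ∈ Ioo (α / (α - 1)) ((1 + ω / 2) / (α - 1)))
    {s : ℕ → ℕ} (hs_pos : ∀ᶠ n in atTop, 1 ≤ s n)
    (hs : (fun n : ℕ => (s n : ℝ)) =o[atTop] fun n : ℕ => (n : ℝ)) :
    IsAdaptiveHyperprior ω α s (betaHyperprior c) := by
  obtain ⟨hr_tend, hL_tend⟩ := tendsto_log_div_atTop hs_pos hs
  have hα1 : 0 < α - 1 := by linarith
  have hb0 : 0 < α / (α - 1) := by positivity
  have hc0 : 0 < c := hb0.trans hc.1
  refine ⟨?_, Eventually.of_forall fun n => betaHyperprior_Iic_zero c n, ?_, ?_⟩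
  · filter_upwards [eventually_gt_atTop 0] with n hn
    exact isProbabilityMeasure_betaHyperprior c hn
  · have hlim : Tendsto (fun n : ℕ => ((3 / Real.log ((n : ℝ) / s n) : ℝ) : EReal)) atTop
        (𝓝 0) := by
      rw [← EReal.coe_zero]
      exact EReal.tendsto_coe.2 (hL_tend.const_div_atTop 3)
    refine tendsto_of_tendsto_of_tendsto_of_le_of_le' tendsto_const_nhds hlim ?_ ?_
    · filter_upwards [eventually_gt_atTop 0, hL_tend.eventually_gt_atTop 0] with n hn hL
      have := isProbabilityMeasure_betaHyperprior c hn
      refine EReal.div_nonneg ?_ (by exact_mod_cast (by positivity))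
      have h1 := le_negLogMass (x := 0) (μ := betaHyperprior c n)
        (U := Icc (((s n : ℝ) / n) ^ ((1 + ω / 2) / (α - 1))) (((s n : ℝ) / n) ^ (α / (α - 1))))
        (by rw [neg_zero, Real.exp_zero, ENNReal.ofReal_one]; exact prob_le_one)
      exact_mod_cast h1
    · have hδ : 0 < (1 + ω / 2) / (α - 1) - c := by linarith [hc.2]
      filter_upwards [eventually_gt_atTop 0, hs_pos, hL_tend.eventually_gt_atTop 0,
        hr_tend.eventually (Ioc_mem_nhdsGT (show (0 : ℝ) < 1 / 2 by norm_num)),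
        hr_tend.eventually (eventually_rpow_lt (C := 2 ^ c) hδ one_pos)] with n hn hsn hL hr hrc
      have hs0 : (0 : ℝ) < s n := Nat.cast_pos.2 hsn
      have ha : ((s n : ℝ) / n) ^ ((1 + ω / 2) / (α - 1)) ≤ ((s n : ℝ) / n / 2) ^ c := by
        rw [Real.div_rpow hr.1.le zero_le_two, le_div_iff₀ (by positivity),
          show (1 + ω / 2) / (α - 1) = c + ((1 + ω / 2) / (α - 1) - c) by ring,
          Real.rpow_add hr.1, mul_assoc]
        refine mul_le_of_le_one_right (Real.rpow_nonneg hr.1.le _) ?_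
        linarith
      have h1 := negLogMass_le (le_betaHyperprior_Icc hsn hn hc0 hc.1.le hr.2 ha)
      rw [EReal.div_le_iff_le_mul (by exact_mod_cast (by positivity)) (EReal.coe_ne_top _),
        ← EReal.coe_mul]
      refine h1.trans_eq ?_
      congr 1
      field_simp
  · rw [EReal.tendsto_nhds_top_iff_real]
    intro K
    have hδ : 0 < 1 - α / (α - 1) / c := by
      rw [sub_pos, div_lt_one hc0]
      exact hc.1
    -- Three of the extra units cover the terms `1`, `s` and `log (n/s)`, each at most `s log
    -- (n/s)`; the fourth gives strictness.
    have hgrow : ∀ᶠ x : ℝ in atTop, (|K| + 4) * x ≤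
        Real.exp ((1 - α / (α - 1) / c) * x) := by
      have h1 := tendsto_exp_mul_div_rpow_atTop 1 _ hδ
      filter_upwards [h1.eventually_ge_atTop (|K| + 4), eventually_gt_atTop 0] with x hx hx0
      rwa [Real.rpow_one, le_div_iff₀ hx0] at hx
    filter_upwards [eventually_gt_atTop 0, hs_pos, hL_tend.eventually_ge_atTop 1,
      hr_tend.eventually (Ioc_mem_nhdsGT one_pos), hL_tend.eventually hgrow] with n hn hsn hL hr hg
    have hs1 : (1 : ℝ) ≤ s n := by exact_mod_cast hsn
    have hsL : 0 < (s n : ℝ) * Real.log ((n : ℝ) / s n) := by positivity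
    have h1 := le_negLogMass (betaHyperprior_Ici_le hsn hn hc0 hb0.le hr.2)
    rw [EReal.lt_div_iff (by exact_mod_cast hsL) (EReal.coe_ne_top _), ← EReal.coe_mul]
    refine lt_of_lt_of_le ?_ h1
    rw [EReal.coe_lt_coe_iff]
    set L := Real.log ((n : ℝ) / s n)
    have h2 : (s n : ℝ) * ((|K| + 4) * L) ≤
        s n * Real.exp ((1 - α / (α - 1) / c) * L) := by gcongr
    have h3 : K * (s n * L) ≤ |K| * (s n * L) := by
      gcongr
      exact le_abs_self K
    have h4 : L ≤ s n * L := le_mul_of_one_le_left (by linarith) hs1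
    have h5 : (s n : ℝ) ≤ s n * L := le_mul_of_one_le_right (by linarith) hL
    linarith

theorem theorem3 (ω α : ℝ) (hω : 0 < ω) (hα : 1 < α) (hαω : α ≤ 1 + ω / 2)
    (π₀ : ℝ → ℝ) (hπ₀ : IsPolynomialTailDensity π₀ α)
    (s : ℕ → ℕ) (hs_pos : ∀ᶠ n in atTop, 1 ≤ s n)
    (hs : (fun n : ℕ => (s n : ℝ)) =o[atTop] fun n : ℕ => (n : ℝ))
    (θs : ∀ n, Fin n → ℝ)
    (hθs : ∀ n, (Finset.univ.filter fun j : Fin n => θs n j ≠ 0).card = s n)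
    (hθs_le : ∀ᶠ n : ℕ in atTop, ∀ j, |θs n j| ≤ ((n : ℝ) / s n) ^ (ω / (5 * α))) :
    (∀ ν : ℕ → Measure ℝ, IsAdaptiveHyperprior ω α s ν →
      ContractsL2 ω π₀ s θs ν ∧ ContractsL1 ω π₀ s θs ν) ∧
    (∀ c ∈ Ioo (α / (α - 1)) ((1 + ω / 2) / (α - 1)),
      IsAdaptiveHyperprior ω α s (betaHyperprior c) ∧
      ContractsL2 ω π₀ s θs (betaHyperprior c) ∧ ContractsL1 ω π₀ s θs (betaHyperprior c)) ∧
    Tendsto constL2 (𝓝[>] 0) (𝓝 √2) ∧ Tendsto constL1 (𝓝[>] 0) (𝓝 √2) := by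
  have main : ∀ ν : ℕ → Measure ℝ, IsAdaptiveHyperprior ω α s ν →
      ContractsL2 ω π₀ s θs ν ∧ ContractsL1 ω π₀ s θs ν := fun ν hν =>
    ⟨contractsL2_of_isAdaptiveHyperprior hω hα hπ₀ hs_pos hs hθs hθs_le hν,
      contractsL1_of_isAdaptiveHyperprior hω hα hπ₀ hs_pos hs hθs hθs_le hν⟩
  refine ⟨main, fun c hc => ?_, tendsto_constL2, tendsto_constL1⟩
  have hν := isAdaptiveHyperprior_betaHyperprior (ω := ω) hα hc hs_pos hs
  exact ⟨hν, main _ hν⟩
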